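/- All manifolds are finite-dimensional, smooth, Hausdorff and without boundary. **Definitions.** A *symplectic Lie group* $(G,\omega)$ is a Lie group $G$ with a symplectic form $\omega$ such that $l_g^*\omega=\omega$ for all left translations $l_g$. A *quasi-Frobenius Lie algebra* $(\mathfrak q,\beta)$ is a real Lie algebra $\mathfrak q$ with a nondegenerate 2-cocycle $\beta\in\wedge^2\mathfrak q^*$ (with trivial coefficients $\mathbb R$); the one associated with $(G,\omega)$ is $(\mathfrak g,\omega_e)$, where $\mathfrak g=T_eG$ is the Lie algebra of $G$. A *symplectic Lie group bundle* (SLGB) $(G,\omega,E,\pi,M,\widetilde\omega)$ consists of a symplectic Lie group $(G,\omega)$, a smooth fibre bundle $\pi:E\to M$ with fibre $G$, and a smooth section $\widetilde\omega$ of $\wedge^2(\ker\pi_*)^*$, such that (a) each fibre $E_p=\pi^{-1}(p)$, with its smooth structure of embedded submanifold of $E$, is a Lie group; (b) the restriction of $\widetilde\omega$ to each $E_p$ is a left-invariant symplectic form; (c) $M$ is covered by open sets $U_i$ with smooth local trivializations $\psi_i:\pi^{-1}(U_i)\to U_i\times G$ that restrict, for every $p\in U_i$, to isomorphisms of symplectic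 Lie groups $(E_p,\widetilde\omega|_{E_p})\to(G,\omega)$. The canonical groupoid $E\rightrightarrows M$ of an SLGB has source and target $s=t=\pi$, units $u(p)=1_p$ (the identity element of $E_p$), and the multiplication and inversion of the fibres; $\widetilde\omega$ is its $t$-symplectic form. For a Lie groupoid $\mathcal G\rightrightarrows M$ with source $s$, target $t$ and unit map $u$, the associated Lie algebroid is $A\mathcal G=(\ker t_*)|_{u(M)}$, regarded as a vector bundle over $M$, with anchor $\rho=s_*|_{A\mathcal G}$ and bracket $[X,Y]=[\widetilde X,\widetilde Y]|_{u(M)}$ for $X,Y\in\Gamma(A\mathcal G)$, where $\widetilde X_g=(l_g)_*X_{s(g)}$ is the left-invariant vector field on $\mathcal G$ defined by $X$, and $l_g:t^{-1}(s(g))\to t^{-1}(t(g))$ is left multiplication. A *quasi-Frobenius Lie algebroid* $(A,\rho,M,\beta)$ is a Lie algebroid $(A,\rho,M)$ with a nondegenerate $\beta\in\Gamma(\wedge^2A^*)$ such that $d_A\beta=0$. **Proposition 4.3.** Let $(G,\omega,E,\pi,M,\widetilde\omega)$ be an SLGB. Its canonical groupoid is a Lie groupoid, and with $\beta_p:=\widetilde\omega_{1_p}$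 on $(AE)_p$, $(AE,\rho,M,\beta)$ is a quasi-Frobenius Lie algebroid. Moreover: (i) $\rho\equiv 0$. (ii) The Lie bracket on $\Gamma(AE)$ is $C^\infty(M)$-bilinear. In particular, there is a unique family of brackets $[\cdot,\cdot]_p$ on the fibres $(AE)_p$, $p\in M$, with $[X,Y](p)=[X(p),Y(p)]_p$ for all $X,Y\in\Gamma(AE)$; each $(AE)_p$ is a Lie algebra with this bracket, and $((AE)_p,\beta_p)$ is a quasi-Frobenius Lie algebra. (iii) $(\mathfrak g,\omega_e)$ is a quasi-Frobenius Lie algebra, and $M$ is covered by open sets $U_i$ with smooth local trivializations $\varphi_i:\pi_{AE}^{-1}(U_i)\to U_i\times\mathfrak g$ of the vector bundle $\pi_{AE}:AE\to M$ such that for all $i$ and $p\in U_i$ the induced map $\varphi_{i,p}:((AE)_p,\beta_p)\to(\mathfrak g,\omega_e)$ is an isomorphism of quasi-Frobenius Lie algebras, i.e. a linear isomorphism that preserves the brackets and satisfies $\omega_e(\varphi_{i,p}v,\varphi_{i,p}w)=\beta_p(v,w)$. -/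

import Mathlib

open scoped Manifold ContDiff Bundle Topology
open Set

noncomputable section

/-! ### Symplectic manifolds and symplectic Lie groups -/

section Forms

variable {E : Type*} [NormedAddCommGroup E] [NormedSpace ℝ E]
  {N : Type*} [TopologicalSpace N] [ChartedSpace E N]

/-- A vector field on `N` is smooth if it is a smooth section of the tangent bundle. -/
def IsSmoothVectorField [IsManifold 𝓘(ℝ, E) ∞ N] (X : ∀ x : N, TangentSpace 𝓘(ℝ, E) x) : Prop :=
  ContMDiff 𝓘(ℝ, E) 𝓘(ℝ, E).tangent ∞ (fun x => (⟨x, X x⟩ : TangentBundle 𝓘(ℝ, E) N))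

/-- The derivative `X f` at the point `x` of a real function along a tangent vector at `x`. -/
def dirDeriv (f : N → ℝ) (x : N) (v : TangentSpace 𝓘(ℝ, E) x) : ℝ :=
  mfderiv 𝓘(ℝ, E) 𝓘(ℝ, ℝ) f x v

/-- `σ` is a smooth differential 2-form on the manifold `N`: it is alternating at every point and
its value on any two smooth vector fields is a smooth function. -/
structure IsTwoForm [IsManifold 𝓘(ℝ, E) ∞ N]
    (σ : ∀ x : N, LinearMap.BilinForm ℝ (TangentSpace 𝓘(ℝ, E) x)) : Prop where
  alt : ∀ x, (σ x).IsAlt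
  smooth : ∀ X Y : (∀ x : N, TangentSpace 𝓘(ℝ, E) x), IsSmoothVectorField X →
    IsSmoothVectorField Y → ContMDiff 𝓘(ℝ, E) 𝓘(ℝ, ℝ) ∞ (fun x => σ x (X x) (Y x))

/-- The value `(dσ)(X, Y, Z)` of the exterior derivative of a 2-form, as a function on `N`. -/
def extDerivTwoForm (σ : ∀ x : N, LinearMap.BilinForm ℝ (TangentSpace 𝓘(ℝ, E) x))
    (X Y Z : ∀ x : N, TangentSpace 𝓘(ℝ, E) x) (x : N) : ℝ :=
  dirDeriv (fun y => σ y (Y y) (Z y)) x (X x)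
    - dirDeriv (fun y => σ y (X y) (Z y)) x (Y x)
    + dirDeriv (fun y => σ y (X y) (Y y)) x (Z x)
    - σ x (VectorField.mlieBracket 𝓘(ℝ, E) X Y x) (Z x)
    + σ x (VectorField.mlieBracket 𝓘(ℝ, E) X Z x) (Y x)
    - σ x (VectorField.mlieBracket 𝓘(ℝ, E) Y Z x) (X x)

/-- `σ` is a symplectic form on `N`: a closed and nondegenerate smooth 2-form. -/
structure IsSymplecticForm [IsManifold 𝓘(ℝ, E) ∞ N]
    (σ : ∀ x : N, LinearMap.BilinForm ℝ (TangentSpace 𝓘(ℝ, E) x)) : Prop where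
  isTwoForm : IsTwoForm σ
  nondegenerate : ∀ x, (σ x).Nondegenerate
  closed : ∀ X Y Z : (∀ x : N, TangentSpace 𝓘(ℝ, E) x), IsSmoothVectorField X →
    IsSmoothVectorField Y → IsSmoothVectorField Z → ∀ x, extDerivTwoForm σ X Y Z x = 0

/-- `(N, σ)` is a symplectic Lie group: `σ` is a symplectic form on the Lie group `N` and
`l_g^* σ = σ` for all left translations `l_g`. -/
structure IsSymplecticLieGroup [Group N] [LieGroup 𝓘(ℝ, E) ∞ N]
    (σ : ∀ x : N, LinearMap.BilinForm ℝ (TangentSpace 𝓘(ℝ, E) x)) : Prop where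
  symplectic : IsSymplecticForm σ
  leftInvariant : ∀ (g h : N) (v w : TangentSpace 𝓘(ℝ, E) h),
    σ (g * h) (mfderiv 𝓘(ℝ, E) 𝓘(ℝ, E) (fun x => g * x) h v)
      (mfderiv 𝓘(ℝ, E) 𝓘(ℝ, E) (fun x => g * x) h w) = σ h v w

/-- `f : (N, η) → (N', σ)` is an isomorphism of symplectic Lie groups: a diffeomorphism which is a
group homomorphism and satisfies `f^* σ = η`. -/
structure IsSymplecticLieGroupIso [Group N]
    {E' : Type*} [NormedAddCommGroup E'] [NormedSpace ℝ E']
    {N' : Type*} [TopologicalSpace N'] [ChartedSpace E' N'] [Group N']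
    (η : ∀ x : N, LinearMap.BilinForm ℝ (TangentSpace 𝓘(ℝ, E) x))
    (σ : ∀ x : N', LinearMap.BilinForm ℝ (TangentSpace 𝓘(ℝ, E') x)) (f : N → N') : Prop where
  diffeo : ∃ Φ : Diffeomorph 𝓘(ℝ, E) 𝓘(ℝ, E') N N' ∞, ∀ x, Φ x = f x
  map_mul : ∀ x y, f (x * y) = f x * f y
  pullback : ∀ (x : N) (v w : TangentSpace 𝓘(ℝ, E) x),
    σ (f x) (mfderiv 𝓘(ℝ, E) 𝓘(ℝ, E') f x v) (mfderiv 𝓘(ℝ, E) 𝓘(ℝ, E') f x w) = η x v w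

end Forms

/-! ### Quasi-Frobenius Lie algebras -/

/-- `(V, b, β)` is a quasi-Frobenius Lie algebra over `ℝ`: `b` is a Lie bracket on the real vector
space `V` and `β` is a nondegenerate (alternating) 2-cocycle with values in the trivial module. -/
structure IsQuasiFrobeniusLieAlgebra {V : Type*} [AddCommGroup V] [Module ℝ V]
    (b : V → V → V) (β : LinearMap.BilinForm ℝ V) : Prop where
  add_left : ∀ x y z, b (x + y) z = b x z + b y z
  smul_left : ∀ (c : ℝ) x y, b (c • x) y = c • b x y
  add_right : ∀ x y z, b x (y + z) = b x y + b x z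
  smul_right : ∀ (c : ℝ) x y, b x (c • y) = c • b x y
  bracket_self : ∀ x, b x x = 0
  jacobi : ∀ x y z, b x (b y z) = b (b x y) z + b y (b x z)
  alt : β.IsAlt
  nondegenerate : β.Nondegenerate
  cocycle : ∀ x y z, - β (b x y) z + β (b x z) y - β (b y z) x = 0

/-! ### Lie groupoids and their Lie algebroids -/

/-- A groupoid `Γ ⇉ M` with source `s`, target `t`, unit map `u`, inversion `inv` and
multiplication `mul`.  The product `g h` is meaningful when `s g = t h`; the value of `mul g h`
for other pairs is irrelevant. -/
structure GroupoidOver (Γ M : Type*) where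
  s : Γ → M
  t : Γ → M
  u : M → Γ
  inv : Γ → Γ
  mul : Γ → Γ → Γ
  s_mul : ∀ g h, s g = t h → s (mul g h) = s h
  t_mul : ∀ g h, s g = t h → t (mul g h) = t g
  mul_assoc : ∀ g h k, s g = t h → s h = t k → mul (mul g h) k = mul g (mul h k)
  s_u : ∀ p, s (u p) = p
  t_u : ∀ p, t (u p) = p
  u_mul : ∀ g, mul (u (t g)) g = g
  mul_u : ∀ g, mul g (u (s g)) = g
  s_inv : ∀ g, s (inv g) = t g
  t_inv : ∀ g, t (inv g) = s g
  inv_mul : ∀ g, mul (inv g) g = u (s g)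
  mul_inv : ∀ g, mul g (inv g) = u (t g)

namespace GroupoidOver

variable {EΓ : Type*} [NormedAddCommGroup EΓ] [NormedSpace ℝ EΓ]
  {Γ : Type*} [TopologicalSpace Γ] [ChartedSpace EΓ Γ]
  {EM : Type*} [NormedAddCommGroup EM] [NormedSpace ℝ EM]
  {M : Type*} [TopologicalSpace M] [ChartedSpace EM M]

variable (EΓ EM) in
/-- The groupoid is a Lie groupoid: all structure maps are smooth and the source map is a surjective
submersion.  Multiplication is smooth on the embedded submanifold of composable pairs. -/
structure IsLieGroupoid (𝒢 : GroupoidOver Γ M) : Prop where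
  smooth_s : ContMDiff 𝓘(ℝ, EΓ) 𝓘(ℝ, EM) ∞ 𝒢.s
  smooth_t : ContMDiff 𝓘(ℝ, EΓ) 𝓘(ℝ, EM) ∞ 𝒢.t
  smooth_u : ContMDiff 𝓘(ℝ, EM) 𝓘(ℝ, EΓ) ∞ 𝒢.u
  smooth_inv : ContMDiff 𝓘(ℝ, EΓ) 𝓘(ℝ, EΓ) ∞ 𝒢.inv
  smooth_mul : ContMDiffOn (𝓘(ℝ, EΓ).prod 𝓘(ℝ, EΓ)) 𝓘(ℝ, EΓ) ∞
    (fun z : Γ × Γ => 𝒢.mul z.1 z.2) {z | 𝒢.s z.1 = 𝒢.t z.2}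
  surjective_s : Function.Surjective 𝒢.s
  submersion_s : ∀ g, Function.Surjective (mfderiv 𝓘(ℝ, EΓ) 𝓘(ℝ, EM) 𝒢.s g)

variable (EΓ EM) in
/-- The fibre at `p` of the Lie algebroid `A𝒢 = (ker t_*)|_M`, a subspace of the tangent space of
`Γ` at the unit of `p`. -/
def A (𝒢 : GroupoidOver Γ M) (p : M) : Submodule ℝ (TangentSpace 𝓘(ℝ, EΓ) (𝒢.u p)) :=
  LinearMap.ker (mfderiv 𝓘(ℝ, EΓ) 𝓘(ℝ, EM) 𝒢.t (𝒢.u p)).toLinearMap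

variable (EΓ EM) in
/-- The anchor `ρ = s_*|_{A𝒢}` (recall that `s (u p) = p`). -/
def anchor (𝒢 : GroupoidOver Γ M) (p : M) :
    𝒢.A EΓ EM p →ₗ[ℝ] TangentSpace 𝓘(ℝ, EM) (𝒢.s (𝒢.u p)) :=
  (mfderiv 𝓘(ℝ, EΓ) 𝓘(ℝ, EM) 𝒢.s (𝒢.u p)).toLinearMap ∘ₗ (𝒢.A EΓ EM p).subtype

variable (EΓ EM) in
/-- `X` is a smooth section of `A𝒢`, i.e. `X ∈ Γ(A𝒢)`.  The vector bundle `A𝒢` is regarded as a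
submanifold of the tangent bundle of `Γ`. -/
structure IsSection [IsManifold 𝓘(ℝ, EΓ) ∞ Γ] (𝒢 : GroupoidOver Γ M)
    (X : ∀ p, TangentSpace 𝓘(ℝ, EΓ) (𝒢.u p)) : Prop where
  mem : ∀ p, X p ∈ 𝒢.A EΓ EM p
  smooth : ContMDiff 𝓘(ℝ, EM) 𝓘(ℝ, EΓ).tangent ∞
    (fun p => (⟨𝒢.u p, X p⟩ : TangentBundle 𝓘(ℝ, EΓ) Γ))

/-- The left-invariant vector field `X̃_g = (l_g)_* X_{s(g)}` on `Γ`, where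
`l_g : t⁻¹(s(g)) → t⁻¹(t(g))` is left multiplication by `g`.  The differential of `l_g` is the
derivative within the `t`-fibre `t⁻¹(s(g))`; that set has a tangent space smaller than the one
of `Γ`, but the values of the derivative on vectors tangent to the fibre (the only ones that
matter for sections of `A𝒢`) are uniquely determined.  As `g (u (s g)) = g`, the result is a
tangent vector at `g`. -/
def leftInv (𝒢 : GroupoidOver Γ M) (X : ∀ p, TangentSpace 𝓘(ℝ, EΓ) (𝒢.u p)) (g : Γ) :
    TangentSpace 𝓘(ℝ, EΓ) g :=
  mfderivWithin 𝓘(ℝ, EΓ) 𝓘(ℝ, EΓ) (fun h => 𝒢.mul g h) (𝒢.t ⁻¹' {𝒢.s g}) (𝒢.u (𝒢.s g))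
    (X (𝒢.s g))

/-- The bracket `[X, Y] = [X̃, Ỹ]|_M` on sections of `A𝒢`. -/
def bracket (𝒢 : GroupoidOver Γ M) (X Y : ∀ p, TangentSpace 𝓘(ℝ, EΓ) (𝒢.u p)) :
    ∀ p, TangentSpace 𝓘(ℝ, EΓ) (𝒢.u p) :=
  fun p => VectorField.mlieBracket 𝓘(ℝ, EΓ) (𝒢.leftInv X) (𝒢.leftInv Y) (𝒢.u p)

variable (EΓ EM) in
/-- `(A𝒢, ρ, M)` with the bracket above is a Lie algebroid: `Γ(A𝒢)` is a real Lie algebra, and the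
Leibniz rule holds. -/
structure IsLieAlgebroid [IsManifold 𝓘(ℝ, EΓ) ∞ Γ] (𝒢 : GroupoidOver Γ M) : Prop where
  bracket_isSection : ∀ X Y, 𝒢.IsSection EΓ EM X → 𝒢.IsSection EΓ EM Y →
    𝒢.IsSection EΓ EM (𝒢.bracket X Y)
  bracket_add : ∀ X Y Z, 𝒢.IsSection EΓ EM X → 𝒢.IsSection EΓ EM Y → 𝒢.IsSection EΓ EM Z →
    𝒢.bracket X (Y + Z) = 𝒢.bracket X Y + 𝒢.bracket X Z
  bracket_smul : ∀ (c : ℝ) X Y, 𝒢.IsSection EΓ EM X → 𝒢.IsSection EΓ EM Y →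
    𝒢.bracket X (c • Y) = c • 𝒢.bracket X Y
  bracket_skew : ∀ X Y, 𝒢.IsSection EΓ EM X → 𝒢.IsSection EΓ EM Y →
    𝒢.bracket X Y = - 𝒢.bracket Y X
  jacobi : ∀ X Y Z, 𝒢.IsSection EΓ EM X → 𝒢.IsSection EΓ EM Y → 𝒢.IsSection EΓ EM Z →
    𝒢.bracket X (𝒢.bracket Y Z) = 𝒢.bracket (𝒢.bracket X Y) Z + 𝒢.bracket Y (𝒢.bracket X Z)
  leibniz : ∀ X Y (hX : 𝒢.IsSection EΓ EM X), 𝒢.IsSection EΓ EM Y →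
    ∀ f : M → ℝ, ContMDiff 𝓘(ℝ, EM) 𝓘(ℝ, ℝ) ∞ f → ∀ p,
    𝒢.bracket X (fun q => f q • Y q) p =
      f p • 𝒢.bracket X Y p + dirDeriv f _ (𝒢.anchor EΓ EM p ⟨X p, hX.mem p⟩) • Y p

variable (EΓ EM) in
/-- `(A𝒢, ρ, M, β)` is a quasi-Frobenius Lie algebroid: `β ∈ Γ(∧² A𝒢^*)` is nondegenerate and
`d_{A𝒢} β = 0`. -/
structure IsQuasiFrobeniusLieAlgebroid [IsManifold 𝓘(ℝ, EΓ) ∞ Γ] (𝒢 : GroupoidOver Γ M)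
    (β : ∀ p, LinearMap.BilinForm ℝ (𝒢.A EΓ EM p)) : Prop where
  isLieAlgebroid : 𝒢.IsLieAlgebroid EΓ EM
  alt : ∀ p, (β p).IsAlt
  smooth : ∀ X Y (hX : 𝒢.IsSection EΓ EM X) (hY : 𝒢.IsSection EΓ EM Y),
    ContMDiff 𝓘(ℝ, EM) 𝓘(ℝ, ℝ) ∞ (fun p => β p ⟨X p, hX.mem p⟩ ⟨Y p, hY.mem p⟩)
  nondegenerate : ∀ p, (β p).Nondegenerate
  closed : ∀ X Y Z (hX : 𝒢.IsSection EΓ EM X) (hY : 𝒢.IsSection EΓ EM Y)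
    (hZ : 𝒢.IsSection EΓ EM Z) (p : M),
    dirDeriv (fun q => β q ⟨Y q, hY.mem q⟩ ⟨Z q, hZ.mem q⟩) _
        (𝒢.anchor EΓ EM p ⟨X p, hX.mem p⟩)
      - dirDeriv (fun q => β q ⟨X q, hX.mem q⟩ ⟨Z q, hZ.mem q⟩) _
        (𝒢.anchor EΓ EM p ⟨Y p, hY.mem p⟩)
      + dirDeriv (fun q => β q ⟨X q, hX.mem q⟩ ⟨Y q, hY.mem q⟩) _
        (𝒢.anchor EΓ EM p ⟨Z p, hZ.mem p⟩)
      - β p ⟨𝒢.bracket X Y p, (isLieAlgebroid.bracket_isSection X Y hX hY).mem p⟩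
        ⟨Z p, hZ.mem p⟩
      + β p ⟨𝒢.bracket X Z p, (isLieAlgebroid.bracket_isSection X Z hX hZ).mem p⟩
        ⟨Y p, hY.mem p⟩
      - β p ⟨𝒢.bracket Y Z p, (isLieAlgebroid.bracket_isSection Y Z hY hZ).mem p⟩
        ⟨X p, hX.mem p⟩ = 0

variable (EΓ EM) in
/-- The family `b` of operations on the fibres of `A𝒢` induces the bracket of sections:
`[X, Y]_p = b_p (X_p, Y_p)`. -/
def InducesBracket [IsManifold 𝓘(ℝ, EΓ) ∞ Γ] (𝒢 : GroupoidOver Γ M)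
    (b : ∀ p, 𝒢.A EΓ EM p → 𝒢.A EΓ EM p → 𝒢.A EΓ EM p) : Prop :=
  ∀ X Y (hX : 𝒢.IsSection EΓ EM X) (hY : 𝒢.IsSection EΓ EM Y) (p : M),
    𝒢.bracket X Y p = (b p ⟨X p, hX.mem p⟩ ⟨Y p, hY.mem p⟩ : 𝒢.A EΓ EM p)

variable (EΓ EM) in
/-- The part `π_{A𝒢}⁻¹(U)` of the total space of `A𝒢` over `U`, as a subset of the tangent bundle
of `Γ`. -/
def totalOver (𝒢 : GroupoidOver Γ M) (U : Set M) : Set (TangentBundle 𝓘(ℝ, EΓ) Γ) :=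
  {w | ∃ p ∈ U, ∃ v ∈ 𝒢.A EΓ EM p, w = ⟨𝒢.u p, v⟩}

end GroupoidOver

/-! ### Symplectic Lie group bundles -/

section Bundle

variable {EP : Type*} [NormedAddCommGroup EP] [NormedSpace ℝ EP]
  {P : Type*} [TopologicalSpace P] [ChartedSpace EP P]
  {EM : Type*} [NormedAddCommGroup EM] [NormedSpace ℝ EM]
  {M : Type*} [TopologicalSpace M] [ChartedSpace EM M]

variable (EP EM) in
/-- The vertical space `ker proj_*` at a point. -/
def vertical (proj : P → M) (x : P) : Submodule ℝ (TangentSpace 𝓘(ℝ, EP) x) :=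
  LinearMap.ker (mfderiv 𝓘(ℝ, EP) 𝓘(ℝ, EM) proj x).toLinearMap

/-- `Ω` is a smooth section of `∧² (ker proj_*)^*`: it is alternating and its value on any two smooth
vertical vector fields is a smooth function. -/
structure IsVerticalTwoForm [IsManifold 𝓘(ℝ, EP) ∞ P] (proj : P → M)
    (Ω : ∀ x : P, LinearMap.BilinForm ℝ (vertical EP EM proj x)) : Prop where
  alt : ∀ x, (Ω x).IsAlt
  smooth : ∀ X Y : (∀ x : P, TangentSpace 𝓘(ℝ, EP) x), IsSmoothVectorField X →
    IsSmoothVectorField Y → ∀ (hX : ∀ x, X x ∈ vertical EP EM proj x)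
    (hY : ∀ x, Y x ∈ vertical EP EM proj x),
    ContMDiff 𝓘(ℝ, EP) 𝓘(ℝ, ℝ) ∞ (fun x => Ω x ⟨X x, hX x⟩ ⟨Y x, hY x⟩)

variable {EG : Type*} [NormedAddCommGroup EG] [NormedSpace ℝ EG]

/-- The inclusion `γ_p : T(E_p) → ker proj_*` of the tangent spaces of a fibre `E_p = proj⁻¹(p)`, which
is an embedded submanifold, into the vertical spaces. -/
def fiberInclusion {proj : P → M} (hproj : ContMDiff 𝓘(ℝ, EP) 𝓘(ℝ, EM) ∞ proj) {p : M}
    [ChartedSpace EG (proj ⁻¹' {p})]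
    (hι : Manifold.IsSmoothEmbedding 𝓘(ℝ, EG) 𝓘(ℝ, EP) ∞ (Subtype.val : proj ⁻¹' {p} → P))
    (x : proj ⁻¹' {p}) : TangentSpace 𝓘(ℝ, EG) x →ₗ[ℝ] vertical EP EM proj x.1 :=
  LinearMap.codRestrict (vertical EP EM proj x.1)
    (mfderiv 𝓘(ℝ, EG) 𝓘(ℝ, EP) (Subtype.val : proj ⁻¹' {p} → P) x).toLinearMap (by
      intro v
      have h1 : MDifferentiableAt 𝓘(ℝ, EP) 𝓘(ℝ, EM) proj x.1 :=
        (hproj.mdifferentiable (by simp)) x.1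
      have h2 : MDifferentiableAt 𝓘(ℝ, EG) 𝓘(ℝ, EP) (Subtype.val : proj ⁻¹' {p} → P) x :=
        (hι.contMDiff.mdifferentiable (by simp)) x
      have h3 : proj ∘ (Subtype.val : proj ⁻¹' {p} → P) = fun _ => p := funext fun y => y.2
      have h4 := mfderiv_comp x h1 h2
      rw [h3, mfderiv_const] at h4
      have h5 := congrArg (fun L => L v) h4
      exact h5.symm)

/-- The restriction `γ_p^* Ω` of a section of `∧² (ker proj_*)^*` to the fibre over `p`. -/
def fiberForm {proj : P → M} (hproj : ContMDiff 𝓘(ℝ, EP) 𝓘(ℝ, EM) ∞ proj)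
    (Ω : ∀ x : P, LinearMap.BilinForm ℝ (vertical EP EM proj x)) {p : M}
    [ChartedSpace EG (proj ⁻¹' {p})]
    (hι : Manifold.IsSmoothEmbedding 𝓘(ℝ, EG) 𝓘(ℝ, EP) ∞ (Subtype.val : proj ⁻¹' {p} → P))
    (x : proj ⁻¹' {p}) : LinearMap.BilinForm ℝ (TangentSpace 𝓘(ℝ, EG) x) :=
  (Ω x.1).compl₁₂ (fiberInclusion hproj hι x) (fiberInclusion hproj hι x)

variable (EP EM EG) in
/-- A symplectic Lie group bundle `(G, σ, P, proj, M, Ω)`. -/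
structure SymplecticLieGroupBundle
    (G : Type*) [TopologicalSpace G] [ChartedSpace EG G] [Group G] [LieGroup 𝓘(ℝ, EG) ∞ G]
    (P : Type*) [TopologicalSpace P] [ChartedSpace EP P] [IsManifold 𝓘(ℝ, EP) ∞ P]
    (M : Type*) [TopologicalSpace M] [ChartedSpace EM M] where
  /-- the symplectic form of the model group `G` -/
  σ : ∀ g : G, LinearMap.BilinForm ℝ (TangentSpace 𝓘(ℝ, EG) g)
  isSymplecticLieGroup : IsSymplecticLieGroup σ
  /-- the bundle projection -/
  proj : P → M
  smooth_proj : ContMDiff 𝓘(ℝ, EP) 𝓘(ℝ, EM) ∞ proj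
  /-- the section of `∧² (ker proj_*)^*` -/
  Ω : ∀ x : P, LinearMap.BilinForm ℝ (vertical EP EM proj x)
  isVerticalTwoForm : IsVerticalTwoForm proj Ω
  /-- the smooth structure of the fibres, as embedded submanifolds of the total space -/
  [fiberCharted : ∀ p : M, ChartedSpace EG (proj ⁻¹' {p})]
  fiberEmbedding : ∀ p : M,
    Manifold.IsSmoothEmbedding 𝓘(ℝ, EG) 𝓘(ℝ, EP) ∞ (Subtype.val : proj ⁻¹' {p} → P)
  /-- the Lie group structure of the fibres -/
  [fiberGroup : ∀ p : M, Group (proj ⁻¹' {p})]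
  [fiberLieGroup : ∀ p : M, LieGroup 𝓘(ℝ, EG) ∞ (proj ⁻¹' {p})]
  fiberSymplectic : ∀ p : M,
    IsSymplecticLieGroup (fiberForm (EG := EG) smooth_proj Ω (fiberEmbedding p))
  /-- There are smooth local trivializations (so that `proj` is a smooth fibre bundle with fibre `G`)
  which restrict to isomorphisms of symplectic Lie groups on the fibres. -/
  localTriv : ∀ p₀ : M, ∃ ψ : Bundle.Trivialization G proj, p₀ ∈ ψ.baseSet ∧
    ContMDiffOn 𝓘(ℝ, EP) (𝓘(ℝ, EM).prod 𝓘(ℝ, EG)) ∞ ψ ψ.source ∧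
    ContMDiffOn (𝓘(ℝ, EM).prod 𝓘(ℝ, EG)) 𝓘(ℝ, EP) ∞ ψ.toOpenPartialHomeomorph.symm ψ.target ∧
    ∀ p ∈ ψ.baseSet, IsSymplecticLieGroupIso (fiberForm (EG := EG) smooth_proj Ω (fiberEmbedding p)) σ
      (fun x : proj ⁻¹' {p} => (ψ x.1).2)

namespace SymplecticLieGroupBundle

attribute [instance] fiberCharted fiberGroup fiberLieGroup

variable {G : Type*} [TopologicalSpace G] [ChartedSpace EG G] [Group G] [LieGroup 𝓘(ℝ, EG) ∞ G]
  [IsManifold 𝓘(ℝ, EP) ∞ P]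

/-- The fibrewise product of two elements of the total space (with an irrelevant value if they lie
in different fibres). -/
def fiberMul (S : SymplecticLieGroupBundle EP EM EG G P M) (x y : P) : P :=
  open scoped Classical in
  if h : S.proj x = S.proj y then
    ((⟨x, h⟩ * ⟨y, rfl⟩ : S.proj ⁻¹' {S.proj y}) : P)
  else x

theorem fiberMul_coe (S : SymplecticLieGroupBundle EP EM EG G P M) {p : M} (a b : S.proj ⁻¹' {p}) :
    S.fiberMul a b = ((a * b : S.proj ⁻¹' {p}) : P) := by
  obtain ⟨x, hx⟩ := a
  obtain ⟨y, hy⟩ := b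
  have hx' : S.proj x = p := hx
  have hy' : S.proj y = p := hy
  subst hy'
  simp [fiberMul, hx']

/-- The canonical groupoid structure `P ⇉ M` of a symplectic Lie group bundle: `s = t = proj`, the
units are the identity elements of the fibres, and multiplication and inversion are those of the
fibres. -/
def groupoid (S : SymplecticLieGroupBundle EP EM EG G P M) : GroupoidOver P M where
  s := S.proj
  t := S.proj
  u p := ((1 : S.proj ⁻¹' {p}) : P)
  inv x := (((⟨x, rfl⟩ : S.proj ⁻¹' {S.proj x})⁻¹ : S.proj ⁻¹' {S.proj x}) : P)
  mul := S.fiberMul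
  s_mul x y h := by
    have := S.fiberMul_coe (⟨x, h⟩ : S.proj ⁻¹' {S.proj y}) ⟨y, rfl⟩
    simp only at this
    rw [this]
    exact Subtype.prop (_ : S.proj ⁻¹' {S.proj y})
  t_mul x y h := by
    have := S.fiberMul_coe (⟨x, h⟩ : S.proj ⁻¹' {S.proj y}) ⟨y, rfl⟩
    simp only at this
    rw [this, h]
    exact Subtype.prop (_ : S.proj ⁻¹' {S.proj y})
  mul_assoc x y z hxy hyz := by
    have e1 := S.fiberMul_coe (⟨x, hxy.trans hyz⟩ : S.proj ⁻¹' {S.proj z}) ⟨y, hyz⟩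
    have e2 := S.fiberMul_coe (⟨y, hyz⟩ : S.proj ⁻¹' {S.proj z}) ⟨z, rfl⟩
    simp only at e1 e2
    rw [e1, e2]
    have e3 := S.fiberMul_coe
      ((⟨x, hxy.trans hyz⟩ : S.proj ⁻¹' {S.proj z}) * ⟨y, hyz⟩) ⟨z, rfl⟩
    have e4 := S.fiberMul_coe (⟨x, hxy.trans hyz⟩ : S.proj ⁻¹' {S.proj z}) (⟨y, hyz⟩ * ⟨z, rfl⟩)
    simp only at e3 e4
    rw [e3, e4, mul_assoc]
  s_u p := (1 : S.proj ⁻¹' {p}).2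
  t_u p := (1 : S.proj ⁻¹' {p}).2
  u_mul x := by
    have := S.fiberMul_coe (1 : S.proj ⁻¹' {S.proj x}) ⟨x, rfl⟩
    simpa using this
  mul_u x := by
    have := S.fiberMul_coe (⟨x, rfl⟩ : S.proj ⁻¹' {S.proj x}) 1
    simpa using this
  s_inv x := ((⟨x, rfl⟩ : S.proj ⁻¹' {S.proj x})⁻¹).2
  t_inv x := ((⟨x, rfl⟩ : S.proj ⁻¹' {S.proj x})⁻¹).2
  inv_mul x := by
    have := S.fiberMul_coe (⟨x, rfl⟩ : S.proj ⁻¹' {S.proj x})⁻¹ ⟨x, rfl⟩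
    simpa using this
  mul_inv x := by
    have := S.fiberMul_coe (⟨x, rfl⟩ : S.proj ⁻¹' {S.proj x}) ⟨x, rfl⟩⁻¹
    simpa using this

/-- The 2-cocycle `β = Ω|_M` of the associated quasi-Frobenius Lie algebroid, i.e. the restriction
of the `t`-symplectic form `Ω` of the canonical groupoid to the units. -/
def β (S : SymplecticLieGroupBundle EP EM EG G P M) (p : M) :
    LinearMap.BilinForm ℝ (S.groupoid.A EP EM p) :=
  S.Ω (S.groupoid.u p)

end SymplecticLieGroupBundle

end Bundle

end

/-! Source and target of the canonical groupoid coincide, so the anchor `s_*` restricted to `ker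
t_*` is zero and every derivative term in the Leibniz rule and in `d_A β` disappears. What remains
is a statement about each fibre separately, plus smooth dependence on the base point.

For a section `X`, the left-invariant field `X̃` is tangent to the fibres, and on the Lie group
`E_p` it restricts to the left-invariant field generated by `X(p)`, once `(AE)_p` is identified with
the Lie algebra of `E_p` (`fiberEquiv`, `leftInv_related`). The inclusion of `E_p` therefore relates
these fields, and brackets of related fields are related (`mfderiv_mlieBracket_of_related`). Hence
`[X, Y](p)` is the bracket of `X(p)` and `Y(p)` in the Lie algebra of `E_p`
(`bracket_eq_fiberBracket`). Bilinearity over functions and the Jacobi identity are inherited from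
that Lie algebra. The cocycle identity is closedness of a left-invariant form evaluated on
left-invariant fields, on which the form is constant.

Smoothness is local. In a trivialization, the multiplication extends to a smooth map on all pairs of
points over the base set, and `X̃` is its tangent map applied to `(0, X)`; so `X̃`, brackets of
sections and `β(X, Y)` are smooth. The trivializations of `AE` are the differentials along the units
of the given trivializations `ψ`: on each fibre this is the differential at the identity of an
isomorphism of symplectic Lie groups, hence it preserves bracket and form. Bump functions in these
trivializations extend any vector to a section, which gives uniqueness of the fibre brackets. -/

/-! ### Related vector fields -/

section Related

variable {E : Type*} [NormedAddCommGroup E] [NormedSpace ℝ E]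
  {E' : Type*} [NormedAddCommGroup E'] [NormedSpace ℝ E']

/-- Lie brackets of `f`-related vector fields are `f`-related, in vector spaces. -/
theorem fderiv_lieBracket_of_related {f : E → E'} {V₀ W₀ : E → E} {V W : E' → E'} {x : E}
    (hf : ContDiffAt ℝ 2 f x)
    (hV₀ : DifferentiableAt ℝ V₀ x) (hW₀ : DifferentiableAt ℝ W₀ x)
    (hV : DifferentiableAt ℝ V (f x)) (hW : DifferentiableAt ℝ W (f x))
    (hVr : ∀ᶠ y in 𝓝 x, fderiv ℝ f y (V₀ y) = V (f y))
    (hWr : ∀ᶠ y in 𝓝 x, fderiv ℝ f y (W₀ y) = W (f y)) :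
    fderiv ℝ f x (VectorField.lieBracket ℝ V₀ W₀ x) = VectorField.lieBracket ℝ V W (f x) := by
  have hfd : DifferentiableAt ℝ f x := hf.differentiableAt (by norm_num)
  -- The second-derivative terms of `f` cancel by symmetry, which is where `C²` enters. What remains
  -- are derivatives of `y ↦ Df(y) V₀(y)`, a map equal to `V ∘ f` near `x`, and likewise for `W`.
  rw [VectorField.fderiv_apply_lieBracket hf (by simp) hW₀ hV₀]
  have hV' : (fun y => fderiv ℝ f y (V₀ y)) =ᶠ[𝓝 x] V ∘ f := hVr
  have hW' : (fun y => fderiv ℝ f y (W₀ y)) =ᶠ[𝓝 x] W ∘ f := hWr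
  rw [hV'.fderiv_eq, hW'.fderiv_eq, fderiv_comp x hV hfd, fderiv_comp x hW hfd]
  simp only [ContinuousLinearMap.comp_apply, hVr.self_of_nhds, hWr.self_of_nhds,
    VectorField.lieBracket]

variable {N : Type*} [TopologicalSpace N] [ChartedSpace E N] [IsManifold 𝓘(ℝ, E) 2 N]
  {N' : Type*} [TopologicalSpace N'] [ChartedSpace E' N'] [IsManifold 𝓘(ℝ, E') 2 N']

/-- The representation of a vector field in the chart at `x`. -/
noncomputable def chartField (x : N) (V : ∀ y : N, TangentSpace 𝓘(ℝ, E) y) : E → E :=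
  VectorField.mpullbackWithin 𝓘(ℝ, E) 𝓘(ℝ, E) (extChartAt 𝓘(ℝ, E) x).symm V
    (range 𝓘(ℝ, E))

/-- The inverse derivative hidden in the pullback along the inverse chart is the derivative of the
chart, so the chart representative is a pushforward. -/
theorem chartField_extChartAt (x : N) (V : ∀ y : N, TangentSpace 𝓘(ℝ, E) y) {y : N}
    (hy : y ∈ (extChartAt 𝓘(ℝ, E) x).source) :
    chartField x V (extChartAt 𝓘(ℝ, E) x y) =
      mfderiv 𝓘(ℝ, E) 𝓘(ℝ, E) (extChartAt 𝓘(ℝ, E) x) y (V y) := by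
  have hy' := (extChartAt 𝓘(ℝ, E) x).map_source hy
  have hinv : (mfderivWithin 𝓘(ℝ, E) 𝓘(ℝ, E) (extChartAt 𝓘(ℝ, E) x).symm (range 𝓘(ℝ, E))
      (extChartAt 𝓘(ℝ, E) x y)).inverse =
      mfderiv 𝓘(ℝ, E) 𝓘(ℝ, E) (extChartAt 𝓘(ℝ, E) x)
        ((extChartAt 𝓘(ℝ, E) x).symm (extChartAt 𝓘(ℝ, E) x y)) :=
    ContinuousLinearMap.inverse_eq
      (mfderivWithin_extChartAt_symm_comp_mfderiv_extChartAt hy')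
      (mfderiv_extChartAt_comp_mfderivWithin_extChartAt_symm hy')
  rw [chartField, VectorField.mpullbackWithin_apply, hinv, (extChartAt 𝓘(ℝ, E) x).left_inv hy]

/-- The manifold bracket is the bracket of chart representatives, carried back by the inverse of the
chart derivative; applying that derivative undoes the last step. -/
theorem mfderiv_extChartAt_mlieBracket (V W : ∀ y : N, TangentSpace 𝓘(ℝ, E) y) (x : N) :
    mfderiv 𝓘(ℝ, E) 𝓘(ℝ, E) (extChartAt 𝓘(ℝ, E) x) x
        (VectorField.mlieBracket 𝓘(ℝ, E) V W x) =
      VectorField.lieBracket ℝ (chartField x V) (chartField x W) (extChartAt 𝓘(ℝ, E) x x) := by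
  rw [← VectorField.mlieBracketWithin_univ, VectorField.mlieBracketWithin_apply]
  obtain ⟨e, he⟩ :=
    isInvertible_mfderiv_extChartAt (I := 𝓘(ℝ, E)) (mem_extChartAt_source (I := 𝓘(ℝ, E)) x)
  have hset : (extChartAt 𝓘(ℝ, E) x).symm ⁻¹' univ ∩ range 𝓘(ℝ, E) = univ := by simp
  rw [← he, ContinuousLinearMap.inverse_equiv, hset]
  refine (e.apply_symm_apply _).trans ?_
  exact congrFun (VectorField.lieBracketWithin_univ (V := chartField x V) (W := chartField x W)) _

variable [CompleteSpace E] [CompleteSpace E']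

theorem differentiableAt_chartField {V : ∀ y : N, TangentSpace 𝓘(ℝ, E) y} {x : N}
    (hV : MDifferentiableAt 𝓘(ℝ, E) 𝓘(ℝ, E).tangent
      (fun y => (⟨y, V y⟩ : TangentBundle 𝓘(ℝ, E) N)) x) :
    DifferentiableAt ℝ (chartField x V) (extChartAt 𝓘(ℝ, E) x x) := by
  have := (mdifferentiableWithinAt_univ.2 hV).differentiableWithinAt_mpullbackWithin_vectorField
  have hset : (extChartAt 𝓘(ℝ, E) x).symm ⁻¹' univ ∩ range 𝓘(ℝ, E) = univ := by simp
  rw [hset] at this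
  exact differentiableWithinAt_univ.1 this

/-- Lie brackets of `f`-related vector fields are `f`-related. -/
theorem mfderiv_mlieBracket_of_related {f : N → N'} {V₀ W₀ : ∀ y : N, TangentSpace 𝓘(ℝ, E) y}
    {V W : ∀ y : N', TangentSpace 𝓘(ℝ, E') y} {x : N}
    (hf : ContMDiff 𝓘(ℝ, E) 𝓘(ℝ, E') 2 f)
    (hV₀ : MDifferentiableAt 𝓘(ℝ, E) 𝓘(ℝ, E).tangent
      (fun y => (⟨y, V₀ y⟩ : TangentBundle 𝓘(ℝ, E) N)) x)
    (hW₀ : MDifferentiableAt 𝓘(ℝ, E) 𝓘(ℝ, E).tangent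
      (fun y => (⟨y, W₀ y⟩ : TangentBundle 𝓘(ℝ, E) N)) x)
    (hV : MDifferentiableAt 𝓘(ℝ, E') 𝓘(ℝ, E').tangent
      (fun y => (⟨y, V y⟩ : TangentBundle 𝓘(ℝ, E') N')) (f x))
    (hW : MDifferentiableAt 𝓘(ℝ, E') 𝓘(ℝ, E').tangent
      (fun y => (⟨y, W y⟩ : TangentBundle 𝓘(ℝ, E') N')) (f x))
    (hVr : ∀ y, mfderiv 𝓘(ℝ, E) 𝓘(ℝ, E') f y (V₀ y) = V (f y))
    (hWr : ∀ y, mfderiv 𝓘(ℝ, E) 𝓘(ℝ, E') f y (W₀ y) = W (f y)) :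
    mfderiv 𝓘(ℝ, E) 𝓘(ℝ, E') f x (VectorField.mlieBracket 𝓘(ℝ, E) V₀ W₀ x) =
      VectorField.mlieBracket 𝓘(ℝ, E') V W (f x) := by
  set e := extChartAt 𝓘(ℝ, E) x with he
  set e' := extChartAt 𝓘(ℝ, E') (f x) with he'
  set F : E → E' := e' ∘ f ∘ e.symm with hF
  have hx : x ∈ e.source := mem_extChartAt_source x
  have hfx : f x ∈ e'.source := mem_extChartAt_source (f x)
  have hFx : F (e x) = e' (f x) := by simp [hF, e.left_inv hx]
  -- near `e x` we stay in the chart domains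
  have hnear : ∀ᶠ z in 𝓝 (e x), z ∈ e.target ∧ f (e.symm z) ∈ e'.source := by
    refine Filter.Eventually.and (extChartAt_target_mem_nhds (I := 𝓘(ℝ, E)) x) ?_
    have hc : ContinuousAt (f ∘ e.symm) (e x) :=
      hf.continuous.continuousAt.comp (continuousAt_extChartAt_symm x)
    have : e'.source ∈ 𝓝 ((f ∘ e.symm) (e x)) := by
      rw [Function.comp_apply, e.left_inv hx]
      exact extChartAt_source_mem_nhds (I := 𝓘(ℝ, E')) (f x)
    exact hc this
  have hFC : ContDiffAt ℝ 2 F (e x) := by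
    have h1 := (contMDiffAt_iff.1 (hf.contMDiffAt (x := x))).2
    rw [show range 𝓘(ℝ, E) = univ by simp] at h1
    exact contDiffWithinAt_univ.1 h1
  -- the chain rule for `F ∘ e = e' ∘ f`
  have hchain : ∀ y, y ∈ e.source → f y ∈ e'.source → DifferentiableAt ℝ F (e y) →
      ∀ v : TangentSpace 𝓘(ℝ, E) y, fderiv ℝ F (e y) (mfderiv 𝓘(ℝ, E) 𝓘(ℝ, E) e y v) =
        mfderiv 𝓘(ℝ, E') 𝓘(ℝ, E') e' (f y) (mfderiv 𝓘(ℝ, E) 𝓘(ℝ, E') f y v) := by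
    intro y hy hfy hd v
    have m1 : MDifferentiableAt 𝓘(ℝ, E) 𝓘(ℝ, E) e y :=
      mdifferentiableAt_extChartAt (by simpa [he] using hy)
    have m2 : MDifferentiableAt 𝓘(ℝ, E') 𝓘(ℝ, E') e' (f y) :=
      mdifferentiableAt_extChartAt (by simpa [he'] using hfy)
    have m3 : MDifferentiableAt 𝓘(ℝ, E) 𝓘(ℝ, E') f y := hf.mdifferentiable (by norm_num) y
    have heq : F ∘ e =ᶠ[𝓝 y] e' ∘ f := by
      filter_upwards [(isOpen_extChartAt_source (I := 𝓘(ℝ, E)) x).mem_nhds hy] with z hz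
      simp [hF, e.left_inv hz]
    have c1 := mfderiv_comp y hd.mdifferentiableAt m1
    have c2 := mfderiv_comp y m2 m3
    have c3 := heq.mfderiv_eq (I := 𝓘(ℝ, E)) (I' := 𝓘(ℝ, E'))
    have c4 : mfderiv 𝓘(ℝ, E) 𝓘(ℝ, E') (F ∘ e) y v = mfderiv 𝓘(ℝ, E) 𝓘(ℝ, E') (e' ∘ f) y v :=
      congrArg (fun L : E →L[ℝ] E' => L v) c3
    rw [c1, c2, mfderiv_eq_fderiv] at c4
    exact c4
  -- Relatedness under `f` becomes relatedness of the chart representatives under `F`, which reduces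
  -- the claim to vector spaces.
  have hrel : ∀ (V₀ : ∀ y : N, TangentSpace 𝓘(ℝ, E) y) (V : ∀ y : N', TangentSpace 𝓘(ℝ, E') y),
      (∀ y, mfderiv 𝓘(ℝ, E) 𝓘(ℝ, E') f y (V₀ y) = V (f y)) →
      ∀ᶠ z in 𝓝 (e x), fderiv ℝ F z (chartField x V₀ z) = chartField (f x) V (F z) := by
    intro V₀ V h
    filter_upwards [hnear, hFC.eventually (by simp)] with z hz hz'
    have hzs := e.map_target hz.1
    have hzz : e (e.symm z) = z := e.right_inv hz.1
    have h1 := hchain (e.symm z) hzs hz.2 (by rw [hzz]; exact hz'.differentiableAt (by norm_num))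
      (V₀ (e.symm z))
    rw [h, ← chartField_extChartAt x V₀ hzs, ← chartField_extChartAt (f x) V hz.2] at h1
    rw [← he, hzz] at h1
    exact h1
  have key := fderiv_lieBracket_of_related hFC (differentiableAt_chartField hV₀)
    (differentiableAt_chartField hW₀)
    (by rw [hFx]; exact differentiableAt_chartField hV)
    (by rw [hFx]; exact differentiableAt_chartField hW) (hrel V₀ V hVr) (hrel W₀ W hWr)
  rw [hFx, ← mfderiv_extChartAt_mlieBracket, ← mfderiv_extChartAt_mlieBracket,
    hchain x hx hfx (hFC.differentiableAt (by norm_num))] at key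
  exact (isInvertible_mfderiv_extChartAt (I := 𝓘(ℝ, E')) hfx).injective key

end Related

/-! ### Lie groups and their Lie algebras -/

section LieGroups

variable {E : Type*} [NormedAddCommGroup E] [NormedSpace ℝ E]
  {N : Type*} [TopologicalSpace N] [ChartedSpace E N]
  {E' : Type*} [NormedAddCommGroup E'] [NormedSpace ℝ E']
  {N' : Type*} [TopologicalSpace N'] [ChartedSpace E' N']

/-- All tangent spaces unfold to the model space. Stating equalities there lets base points such as
`g * 1` and `g`, equal only propositionally, be exchanged without transport; the next two lemmas
serve the same purpose. -/
theorem bilinForm_congr_point (σ : ∀ x : N, LinearMap.BilinForm ℝ (TangentSpace 𝓘(ℝ, E) x))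
    {x y : N} (h : x = y) (v w : E) :
    σ x (v : TangentSpace 𝓘(ℝ, E) x) (w : TangentSpace 𝓘(ℝ, E) x) =
      σ y (v : TangentSpace 𝓘(ℝ, E) y) (w : TangentSpace 𝓘(ℝ, E) y) := by
  subst h
  rfl

theorem mfderiv_congr_map {f f' : N → N'} (h : f = f') (x : N) :
    (mfderiv 𝓘(ℝ, E) 𝓘(ℝ, E') f x : E →L[ℝ] E') = mfderiv 𝓘(ℝ, E) 𝓘(ℝ, E') f' x := by
  subst h
  rfl

theorem mfderiv_congr_base (f : N → N') {x x' : N} (h : x = x') :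
    (mfderiv 𝓘(ℝ, E) 𝓘(ℝ, E') f x : E →L[ℝ] E') = mfderiv 𝓘(ℝ, E) 𝓘(ℝ, E') f x' := by
  subst h
  rfl

variable [Group N] [Group N']

/-- The smoothness under which `GroupLieAlgebra` carries its Lie algebra structure; over `ℝ` it is
just `3`. -/
instance LieGroup.minSmoothness_three [LieGroup 𝓘(ℝ, E) ∞ N] :
    LieGroup 𝓘(ℝ, E) (minSmoothness ℝ 3) N := by
  rw [minSmoothness_of_isRCLikeNormedField]
  infer_instance

theorem mulInvariantVectorField_one (v : GroupLieAlgebra 𝓘(ℝ, E) N) :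
    mulInvariantVectorField v (1 : N) = v := by
  have h : (fun x : N => 1 * x) = id := funext one_mul
  have h1 : (mfderiv 𝓘(ℝ, E) 𝓘(ℝ, E) (fun x : N => 1 * x) 1 : E →L[ℝ] E) =
      mfderiv 𝓘(ℝ, E) 𝓘(ℝ, E) (id : N → N) 1 :=
    mfderiv_congr_map h 1
  rw [mfderiv_id] at h1
  exact congrArg (fun L : E →L[ℝ] E => L v) h1

section

variable [LieGroup 𝓘(ℝ, E) ∞ N] [LieGroup 𝓘(ℝ, E') ∞ N']

/-- The value at `g` is the tangent map of multiplication applied to the pair `(0, v)` over `(g,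
1)`, and that pair depends smoothly on `g`. -/
theorem contMDiff_mulInvariantVectorField_infty (v : GroupLieAlgebra 𝓘(ℝ, E) N) :
    IsSmoothVectorField (mulInvariantVectorField v : ∀ g : N, TangentSpace 𝓘(ℝ, E) g) := by
  have hm : ContMDiff (𝓘(ℝ, E).prod 𝓘(ℝ, E)) 𝓘(ℝ, E) ∞ (fun z : N × N => z.1 * z.2) :=
    contMDiff_mul 𝓘(ℝ, E) ∞
  have h1 : ContMDiff 𝓘(ℝ, E) 𝓘(ℝ, E).tangent ∞
      (fun g : N => (⟨g, 0⟩ : TangentBundle 𝓘(ℝ, E) N)) :=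
    Bundle.contMDiff_zeroSection ℝ (TangentSpace 𝓘(ℝ, E))
  have h2 : ContMDiff 𝓘(ℝ, E) 𝓘(ℝ, E).tangent ∞
      (fun _ : N => (⟨1, v⟩ : TangentBundle 𝓘(ℝ, E) N)) := contMDiff_const
  have h3 := ((hm.contMDiff_tangentMap (m := ∞) (by simp)).comp
    contMDiff_equivTangentBundleProd_symm).comp (h1.prodMk h2)
  refine h3.congr fun g => ?_
  have h4 := mfderiv_prod_eq_add_apply (I := 𝓘(ℝ, E)) (I' := 𝓘(ℝ, E)) (I'' := 𝓘(ℝ, E))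
    (f := fun z : N × N => z.1 * z.2) (p := (g, 1)) (v := ((0 : E), (v : E)))
    (hm.mdifferentiable (by simp) (g, 1))
  refine Bundle.TotalSpace.ext (mul_one g).symm (heq_of_eq ?_)
  refine Eq.trans ?_ h4.symm
  refine Eq.trans ?_ (congrArg (fun w : E => w + _) (map_zero _)).symm
  exact (zero_add (_ : E)).symm

variable (E E') in
/-- The map between Lie algebras induced by a map of Lie groups which preserves the identity. -/
noncomputable def lieAlgebraMap (f : N → N') :
    GroupLieAlgebra 𝓘(ℝ, E) N →L[ℝ] GroupLieAlgebra 𝓘(ℝ, E') N' :=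
  (mfderiv 𝓘(ℝ, E) 𝓘(ℝ, E') f 1 : E →L[ℝ] E')

/-- Differentiate `f (g * x) = f g * f x` in `x` at the identity. -/
theorem mfderiv_mulInvariantVectorField {f : N → N'} (hf : ContMDiff 𝓘(ℝ, E) 𝓘(ℝ, E') ∞ f)
    (hmul : ∀ x y, f (x * y) = f x * f y) (v : GroupLieAlgebra 𝓘(ℝ, E) N) (g : N) :
    mfderiv 𝓘(ℝ, E) 𝓘(ℝ, E') f g (mulInvariantVectorField v g) =
      mulInvariantVectorField (lieAlgebraMap E E' f v) (f g) := by
  have h1 : f 1 = 1 := by simpa using hmul 1 1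
  have hd : MDifferentiable 𝓘(ℝ, E) 𝓘(ℝ, E') f := hf.mdifferentiable (by simp)
  have hl : MDifferentiableAt 𝓘(ℝ, E) 𝓘(ℝ, E) (fun x : N => g * x) 1 :=
    (contMDiff_mul_left (n := ∞)).mdifferentiable (by simp) 1
  have hl' : MDifferentiable 𝓘(ℝ, E') 𝓘(ℝ, E') (fun x : N' => f g * x) :=
    (contMDiff_mul_left (n := ∞)).mdifferentiable (by simp)
  have hfun : f ∘ (fun x : N => g * x) = (fun x : N' => f g * x) ∘ f := funext fun x => hmul g x
  have c1 : mfderiv 𝓘(ℝ, E) 𝓘(ℝ, E') (f ∘ (fun x : N => g * x)) 1 =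
      (mfderiv 𝓘(ℝ, E) 𝓘(ℝ, E') f (g * 1)).comp
        (mfderiv 𝓘(ℝ, E) 𝓘(ℝ, E) (fun x : N => g * x) 1) := mfderiv_comp 1 (hd _) hl
  have c2 := mfderiv_comp 1 (hl' (f 1)) (hd 1)
  have c3 : (mfderiv 𝓘(ℝ, E) 𝓘(ℝ, E') (f ∘ (fun x : N => g * x)) 1 : E →L[ℝ] E') =
      mfderiv 𝓘(ℝ, E) 𝓘(ℝ, E') ((fun x : N' => f g * x) ∘ f) 1 :=
    mfderiv_congr_map hfun 1
  rw [c1, c2] at c3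
  have c4 := congrArg (fun L : E →L[ℝ] E' => L v) c3
  have c5 : (mfderiv 𝓘(ℝ, E) 𝓘(ℝ, E') f (g * 1) : E →L[ℝ] E') = mfderiv 𝓘(ℝ, E) 𝓘(ℝ, E') f g :=
    mfderiv_congr_base f (mul_one g)
  have c6 : (mfderiv 𝓘(ℝ, E') 𝓘(ℝ, E') (fun x : N' => f g * x) (f 1) : E' →L[ℝ] E') =
      mfderiv 𝓘(ℝ, E') 𝓘(ℝ, E') (fun x : N' => f g * x) 1 :=
    mfderiv_congr_base _ h1
  refine (congrArg (fun L : E →L[ℝ] E' => L (mulInvariantVectorField v g)) c5.symm).trans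
    (c4.trans ?_)
  exact congrArg (fun L : E' →L[ℝ] E' => L (lieAlgebraMap E E' f v)) c6

variable [CompleteSpace E] [CompleteSpace E']

/-- A smooth homomorphism of Lie groups induces a homomorphism of Lie algebras. -/
theorem lieAlgebraMap_lie {f : N → N'} (hf : ContMDiff 𝓘(ℝ, E) 𝓘(ℝ, E') ∞ f)
    (hmul : ∀ x y, f (x * y) = f x * f y) (v w : GroupLieAlgebra 𝓘(ℝ, E) N) :
    lieAlgebraMap E E' f ⁅v, w⁆ =
      (⁅lieAlgebraMap E E' f v, lieAlgebraMap E E' f w⁆ : GroupLieAlgebra 𝓘(ℝ, E') N') := by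
  have h1 : f 1 = 1 := by simpa using hmul 1 1
  have hd : ∀ u : GroupLieAlgebra 𝓘(ℝ, E) N, MDifferentiable 𝓘(ℝ, E) 𝓘(ℝ, E).tangent
      (fun y => (⟨y, mulInvariantVectorField u y⟩ : TangentBundle 𝓘(ℝ, E) N)) :=
    fun u => (contMDiff_mulInvariantVectorField_infty u).mdifferentiable (by simp)
  have hd' : ∀ u : GroupLieAlgebra 𝓘(ℝ, E') N', MDifferentiable 𝓘(ℝ, E') 𝓘(ℝ, E').tangent
      (fun y => (⟨y, mulInvariantVectorField u y⟩ : TangentBundle 𝓘(ℝ, E') N')) :=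
    fun u => (contMDiff_mulInvariantVectorField_infty u).mdifferentiable (by simp)
  -- A homomorphism relates the left-invariant fields of `v` and `w` to those of their images, so
  -- the brackets at the identity correspond.
  have key := mfderiv_mlieBracket_of_related (x := (1 : N)) (hf.of_le (by norm_cast))
    (hd v 1) (hd w 1) (hd' (lieAlgebraMap E E' f v) (f 1)) (hd' (lieAlgebraMap E E' f w) (f 1))
    (mfderiv_mulInvariantVectorField hf hmul v) (mfderiv_mulInvariantVectorField hf hmul w)
  refine Eq.trans (b := (VectorField.mlieBracket 𝓘(ℝ, E')
    (mulInvariantVectorField (lieAlgebraMap E E' f v))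
    (mulInvariantVectorField (lieAlgebraMap E E' f w)) (f 1) : E')) key ?_
  exact congrArg (fun y : N' => (VectorField.mlieBracket 𝓘(ℝ, E')
    (mulInvariantVectorField (lieAlgebraMap E E' f v))
    (mulInvariantVectorField (lieAlgebraMap E E' f w)) y : E')) h1

/-- The Lie algebra of a symplectic Lie group is a quasi-Frobenius Lie algebra. -/
theorem IsSymplecticLieGroup.isQuasiFrobeniusLieAlgebra
    {σ : ∀ x : N, LinearMap.BilinForm ℝ (TangentSpace 𝓘(ℝ, E) x)} (h : IsSymplecticLieGroup σ) :
    IsQuasiFrobeniusLieAlgebra (V := GroupLieAlgebra 𝓘(ℝ, E) N) (fun x y => ⁅x, y⁆) (σ 1) where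
  add_left := add_lie
  smul_left := smul_lie
  add_right := lie_add
  smul_right c x y := lie_smul c x y
  bracket_self := lie_self
  jacobi := leibniz_lie
  alt := h.symplectic.isTwoForm.alt 1
  nondegenerate := h.symplectic.nondegenerate 1
  cocycle x y z := by
    -- By left invariance the form is constant on left-invariant fields, so the three derivative
    -- terms of `dσ` vanish and only the bracket terms survive.
    have hconst : ∀ u v w : GroupLieAlgebra 𝓘(ℝ, E) N, dirDeriv (fun g : N =>
        σ g (mulInvariantVectorField u g) (mulInvariantVectorField v g)) 1 w = 0 := by
      intro u v w
      have hc : (fun g : N => σ g (mulInvariantVectorField u g) (mulInvariantVectorField v g)) =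
          fun _ => σ 1 u v := by
        funext g
        exact (bilinForm_congr_point σ (mul_one g).symm _ _).trans (h.leftInvariant g 1 u v)
      rw [dirDeriv, hc, mfderiv_const]
      rfl
    have hcl := h.symplectic.closed _ _ _ (contMDiff_mulInvariantVectorField_infty x)
      (contMDiff_mulInvariantVectorField_infty y) (contMDiff_mulInvariantVectorField_infty z) 1
    rw [extDerivTwoForm, hconst, hconst, hconst] at hcl
    simp only [mulInvariantVectorField_one, ← GroupLieAlgebra.bracket_def] at hcl
    linarith

end

/-- Transport of the structure of a quasi-Frobenius Lie algebra along a linear isomorphism. -/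
theorem IsQuasiFrobeniusLieAlgebra.of_linearEquiv {V W : Type*} [AddCommGroup V] [Module ℝ V]
    [AddCommGroup W] [Module ℝ W] {b : W → W → W} {β : LinearMap.BilinForm ℝ W}
    (h : IsQuasiFrobeniusLieAlgebra b β) {b' : V → V → V} {β' : LinearMap.BilinForm ℝ V}
    (e : V ≃ₗ[ℝ] W) (hb : ∀ v w, e (b' v w) = b (e v) (e w))
    (hβ : ∀ v w, β (e v) (e w) = β' v w) : IsQuasiFrobeniusLieAlgebra b' β' where
  add_left x y z := e.injective (by simp [hb, h.add_left])
  smul_left c x y := e.injective (by simp [hb, h.smul_left])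
  add_right x y z := e.injective (by simp [hb, h.add_right])
  smul_right c x y := e.injective (by simp [hb, h.smul_right])
  bracket_self x := e.injective (by simp [hb, h.bracket_self])
  jacobi x y z := e.injective (by simp only [hb, map_add]; exact h.jacobi _ _ _)
  alt x := by rw [← hβ]; exact h.alt _
  nondegenerate := by
    have : β' = β.compl₁₂ e.toLinearMap e.toLinearMap := by
      ext v w
      simp [hβ]
    constructor
    · intro x hx
      refine e.injective (Eq.trans (h.nondegenerate.1 _ fun y => ?_) (map_zero e).symm)
      rw [← e.apply_symm_apply y, hβ]
      exact hx _
    · intro x hx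
      refine e.injective (Eq.trans (h.nondegenerate.2 _ fun y => ?_) (map_zero e).symm)
      rw [← e.apply_symm_apply y, hβ]
      exact hx _
  cocycle x y z := by simp only [← hβ, hb]; exact h.cocycle _ _ _

end LieGroups

/-! ### The canonical groupoid of a symplectic Lie group bundle -/

namespace SymplecticLieGroupBundle

section Groupoid

variable {EG : Type*} [NormedAddCommGroup EG] [NormedSpace ℝ EG]
  {EP : Type*} [NormedAddCommGroup EP] [NormedSpace ℝ EP]
  {EM : Type*} [NormedAddCommGroup EM] [NormedSpace ℝ EM]
  {G : Type*} [TopologicalSpace G] [ChartedSpace EG G] [Group G] [LieGroup 𝓘(ℝ, EG) ∞ G]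
  {P : Type*} [TopologicalSpace P] [ChartedSpace EP P] [IsManifold 𝓘(ℝ, EP) ∞ P]
  {M : Type*} [TopologicalSpace M] [ChartedSpace EM M]
  (S : SymplecticLieGroupBundle EP EM EG G P M)

/-- A smooth local trivialization which restricts to isomorphisms of symplectic Lie groups on the
fibres. -/
structure IsSymplecticTriv (ψ : Bundle.Trivialization G S.proj) : Prop where
  smooth : ContMDiffOn 𝓘(ℝ, EP) (𝓘(ℝ, EM).prod 𝓘(ℝ, EG)) ∞ ψ ψ.source
  smooth_symm : ContMDiffOn (𝓘(ℝ, EM).prod 𝓘(ℝ, EG)) 𝓘(ℝ, EP) ∞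
    ψ.toOpenPartialHomeomorph.symm ψ.target
  iso : ∀ p ∈ ψ.baseSet, IsSymplecticLieGroupIso
    (fiberForm (EG := EG) S.smooth_proj S.Ω (S.fiberEmbedding p)) S.σ
    (fun x : S.proj ⁻¹' {p} => (ψ x.1).2)

theorem exists_isSymplecticTriv (p : M) :
    ∃ ψ : Bundle.Trivialization G S.proj, p ∈ ψ.baseSet ∧ S.IsSymplecticTriv ψ := by
  obtain ⟨ψ, h, h1, h2, h3⟩ := S.localTriv p
  exact ⟨ψ, h, h1, h2, h3⟩

theorem proj_unit (p : M) : S.proj (S.groupoid.u p) = p := S.groupoid.s_u p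

theorem isOpen_preimage_baseSet (ψ : Bundle.Trivialization G S.proj) :
    IsOpen (S.proj ⁻¹' ψ.baseSet) :=
  ψ.open_baseSet.preimage S.smooth_proj.continuous

theorem contMDiff_fiber_val (p : M) :
    ContMDiff 𝓘(ℝ, EG) 𝓘(ℝ, EP) ∞ (Subtype.val : S.proj ⁻¹' {p} → P) :=
  (S.fiberEmbedding p).contMDiff

namespace IsSymplecticTriv

variable {S} {ψ : Bundle.Trivialization G S.proj} (h : S.IsSymplecticTriv ψ)
include h

theorem contMDiffOn_snd :
    ContMDiffOn 𝓘(ℝ, EP) 𝓘(ℝ, EG) ∞ (fun x => (ψ x).2) (S.proj ⁻¹' ψ.baseSet) := by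
  rw [← ψ.source_eq]
  exact contMDiff_snd.comp_contMDiffOn h.smooth

theorem contMDiffOn_symm :
    ContMDiffOn (𝓘(ℝ, EM).prod 𝓘(ℝ, EG)) 𝓘(ℝ, EP) ∞
      (fun z => ψ.toOpenPartialHomeomorph.symm z) (ψ.baseSet ×ˢ univ) := by
  rw [← ψ.target_eq]
  exact h.smooth_symm

theorem snd_unit {p : M} (hp : p ∈ ψ.baseSet) : (ψ (S.groupoid.u p)).2 = 1 := by
  have h1 := (h.iso p hp).map_mul 1 1
  rw [mul_one] at h1
  exact left_eq_mul.1 h1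

theorem snd_mul {x y : P} (hxy : S.proj x = S.proj y) (hy : S.proj y ∈ ψ.baseSet) :
    (ψ (S.groupoid.mul x y)).2 = (ψ x).2 * (ψ y).2 := by
  have h1 := (h.iso _ hy).map_mul ⟨x, hxy⟩ ⟨y, rfl⟩
  rwa [← S.fiberMul_coe] at h1

theorem snd_inv {x : P} (hx : S.proj x ∈ ψ.baseSet) :
    (ψ (S.groupoid.inv x)).2 = (ψ x).2⁻¹ := by
  have h1 := (h.iso _ hx).map_mul ⟨x, rfl⟩⁻¹ ⟨x, rfl⟩
  rw [inv_mul_cancel] at h1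
  exact eq_inv_of_mul_eq_one_left (h1.symm.trans (h.snd_unit hx))

-- A point over the base set is determined by its projection and its group coordinate. This is how
-- units, products and inverses are recognized in a trivialization.
omit h in
theorem symm_eq {x : P} {q : M} {g : G} (hq : q ∈ ψ.baseSet) (hx : S.proj x = q)
    (hg : (ψ x).2 = g) : ψ.toOpenPartialHomeomorph.symm (q, g) = x := by
  subst hx hg
  have h1 : ψ x = (S.proj x, (ψ x).2) := Prod.ext (ψ.coe_fst' hq) rfl
  rw [← h1]
  exact ψ.toOpenPartialHomeomorph.left_inv (ψ.mem_source.2 hq)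

omit h in
theorem proj_symm {q : M} (hq : q ∈ ψ.baseSet) (g : G) :
    S.proj (ψ.toOpenPartialHomeomorph.symm (q, g)) = q :=
  ψ.proj_symm_apply' hq

theorem symm_unit {p : M} (hp : p ∈ ψ.baseSet) :
    ψ.toOpenPartialHomeomorph.symm (p, 1) = S.groupoid.u p :=
  symm_eq hp (S.proj_unit p) (h.snd_unit hp)

theorem symm_mul {x y : P} (hxy : S.proj x = S.proj y) (hy : S.proj y ∈ ψ.baseSet) :
    ψ.toOpenPartialHomeomorph.symm (S.proj y, (ψ x).2 * (ψ y).2) = S.groupoid.mul x y :=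
  symm_eq hy (S.groupoid.s_mul x y hxy) (h.snd_mul hxy hy)

/-- The expression of the multiplication in a trivialization, extended to all pairs of points over
the base set. -/
theorem contMDiffOn_mul :
    ContMDiffOn (𝓘(ℝ, EP).prod 𝓘(ℝ, EP)) 𝓘(ℝ, EP) ∞
      (fun z : P × P => ψ.toOpenPartialHomeomorph.symm (S.proj z.2, (ψ z.1).2 * (ψ z.2).2))
      ((S.proj ⁻¹' ψ.baseSet) ×ˢ (S.proj ⁻¹' ψ.baseSet)) := by
  refine h.contMDiffOn_symm.comp (ContMDiffOn.prodMk ?_ (ContMDiffOn.mul ?_ ?_))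
    fun z hz => ⟨hz.2, mem_univ _⟩
  · exact (S.smooth_proj.comp contMDiff_snd).contMDiffOn
  · exact h.contMDiffOn_snd.comp contMDiffOn_fst fun z hz => hz.1
  · exact h.contMDiffOn_snd.comp _root_.contMDiffOn_snd fun z hz => hz.2

end IsSymplecticTriv

/-- In a trivialization the unit section has constant group coordinate `1`. -/
theorem contMDiff_unit : ContMDiff 𝓘(ℝ, EM) 𝓘(ℝ, EP) ∞ S.groupoid.u := by
  intro p
  obtain ⟨ψ, hp, h⟩ := S.exists_isSymplecticTriv p
  have h1 : ContMDiffOn 𝓘(ℝ, EM) 𝓘(ℝ, EP) ∞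
      (fun q => ψ.toOpenPartialHomeomorph.symm (q, 1)) ψ.baseSet :=
    h.contMDiffOn_symm.comp (contMDiffOn_id.prodMk contMDiffOn_const) fun q hq => ⟨hq, mem_univ _⟩
  exact ((h1.congr fun q hq => (h.symm_unit hq).symm) p hp).contMDiffAt (ψ.open_baseSet.mem_nhds hp)

/-- The canonical groupoid of a symplectic Lie group bundle is a Lie groupoid. -/
theorem isLieGroupoid : S.groupoid.IsLieGroupoid EP EM where
  smooth_s := S.smooth_proj
  smooth_t := S.smooth_proj
  smooth_u := S.contMDiff_unit
  smooth_inv := by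
    intro x
    obtain ⟨ψ, hp, h⟩ := S.exists_isSymplecticTriv (S.proj x)
    have h1 : ContMDiffOn 𝓘(ℝ, EP) 𝓘(ℝ, EP) ∞
        (fun y => ψ.toOpenPartialHomeomorph.symm (S.proj y, (ψ y).2⁻¹)) (S.proj ⁻¹' ψ.baseSet) :=
      h.contMDiffOn_symm.comp (S.smooth_proj.contMDiffOn.prodMk h.contMDiffOn_snd.inv)
        fun y hy => ⟨hy, mem_univ _⟩
    exact ((h1.congr fun y hy => (IsSymplecticTriv.symm_eq hy (S.groupoid.s_inv y)
      (h.snd_inv hy)).symm) x hp).contMDiffAt ((S.isOpen_preimage_baseSet ψ).mem_nhds hp)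
  smooth_mul := by
    rintro ⟨x, y⟩ (hxy : S.proj x = S.proj y)
    obtain ⟨ψ, hp, h⟩ := S.exists_isSymplecticTriv (S.proj y)
    have hU := S.isOpen_preimage_baseSet ψ
    have h1 := (h.contMDiffOn_mul.contMDiffAt (x := (x, y))
      ((hU.prod hU).mem_nhds ⟨by simpa [hxy] using hp, hp⟩)).contMDiffWithinAt
      (s := {z | S.groupoid.s z.1 = S.groupoid.t z.2})
    -- The local formula represents the multiplication only on composable pairs, so the comparison
    -- is made within that set.
    refine h1.congr_of_eventuallyEq_of_mem ?_ hxy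
    filter_upwards [self_mem_nhdsWithin, nhdsWithin_le_nhds
      ((hU.preimage continuous_snd).mem_nhds (show (x, y).2 ∈ S.proj ⁻¹' ψ.baseSet from hp))]
      with z hz hz'
    exact (h.symm_mul hz hz').symm
  surjective_s p := ⟨S.groupoid.u p, S.proj_unit p⟩
  submersion_s x := by
    obtain ⟨ψ, hp, h⟩ := S.exists_isSymplecticTriv (S.proj x)
    -- A local section through `x`, obtained by freezing the group coordinate of `x`. Its derivative
    -- is a right inverse of the derivative of the projection.
    have h1 : ContMDiffOn 𝓘(ℝ, EM) 𝓘(ℝ, EP) ∞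
        (fun q => ψ.toOpenPartialHomeomorph.symm (q, (ψ x).2)) ψ.baseSet :=
      h.contMDiffOn_symm.comp (contMDiffOn_id.prodMk contMDiffOn_const)
        fun q hq => ⟨hq, mem_univ _⟩
    have h2 : MDifferentiableAt 𝓘(ℝ, EM) 𝓘(ℝ, EP)
        (fun q => ψ.toOpenPartialHomeomorph.symm (q, (ψ x).2)) (S.proj x) :=
      (h1.contMDiffAt (ψ.open_baseSet.mem_nhds hp)).mdifferentiableAt (by simp)
    have hx : ψ.toOpenPartialHomeomorph.symm (S.proj x, (ψ x).2) = x :=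
      IsSymplecticTriv.symm_eq hp rfl rfl
    have h3 : HasMFDerivAt 𝓘(ℝ, EP) 𝓘(ℝ, EM) S.proj
        (ψ.toOpenPartialHomeomorph.symm (S.proj x, (ψ x).2)) (mfderiv 𝓘(ℝ, EP) 𝓘(ℝ, EM) S.proj _) :=
      (S.smooth_proj.mdifferentiable (by simp) _).hasMFDerivAt
    have h4 := h3.comp (S.proj x) h2.hasMFDerivAt
    have h5 : HasMFDerivAt 𝓘(ℝ, EM) 𝓘(ℝ, EM) id (S.proj x) (ContinuousLinearMap.id ℝ _) :=
      hasMFDerivAt_id _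
    have h6 : S.proj ∘ (fun q => ψ.toOpenPartialHomeomorph.symm (q, (ψ x).2))
        =ᶠ[𝓝 (S.proj x)] id := by
      filter_upwards [ψ.open_baseSet.mem_nhds hp] with q hq
      exact IsSymplecticTriv.proj_symm hq _
    have h7 := hasMFDerivAt_unique (h4.congr_of_eventuallyEq h6.symm) h5
    intro v
    refine ⟨mfderiv 𝓘(ℝ, EM) 𝓘(ℝ, EP)
        (fun q => ψ.toOpenPartialHomeomorph.symm (q, (ψ x).2)) (S.proj x) v, ?_⟩
    have h8 := congrArg (fun L : EM →L[ℝ] EM => L v) h7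
    refine Eq.trans ?_ h8
    exact congrArg (fun L : EP →L[ℝ] EM => L _) (mfderiv_congr_base S.proj hx.symm)

end Groupoid

end SymplecticLieGroupBundle

/-! ### The Lie algebroid of the canonical groupoid -/

namespace SymplecticLieGroupBundle

section Algebroid

variable {EG : Type*} [NormedAddCommGroup EG] [NormedSpace ℝ EG]
  {EP : Type*} [NormedAddCommGroup EP] [NormedSpace ℝ EP]
  {EM : Type*} [NormedAddCommGroup EM] [NormedSpace ℝ EM]
  {G : Type*} [TopologicalSpace G] [ChartedSpace EG G] [Group G] [LieGroup 𝓘(ℝ, EG) ∞ G]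
  {P : Type*} [TopologicalSpace P] [ChartedSpace EP P] [IsManifold 𝓘(ℝ, EP) ∞ P]
  {M : Type*} [TopologicalSpace M] [ChartedSpace EM M]
  (S : SymplecticLieGroupBundle EP EM EG G P M)

theorem fiberInclusion_apply {p : M} (x : S.proj ⁻¹' {p}) (v : TangentSpace 𝓘(ℝ, EG) x) :
    (fiberInclusion S.smooth_proj (S.fiberEmbedding p) x v : TangentSpace 𝓘(ℝ, EP) x.1) =
      mfderiv 𝓘(ℝ, EG) 𝓘(ℝ, EP) (Subtype.val : S.proj ⁻¹' {p} → P) x v := rfl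

namespace IsSymplecticTriv

variable {S} {ψ : Bundle.Trivialization G S.proj} (h : S.IsSymplecticTriv ψ)
include h

/-- The isomorphism of Lie groups from a fibre to the model group. -/
noncomputable def fiberDiffeo {p : M} (hp : p ∈ ψ.baseSet) :
    Diffeomorph 𝓘(ℝ, EG) 𝓘(ℝ, EG) (S.proj ⁻¹' {p}) G ∞ :=
  (h.iso p hp).diffeo.choose

theorem fiberDiffeo_apply {p : M} (hp : p ∈ ψ.baseSet) (x : S.proj ⁻¹' {p}) :
    h.fiberDiffeo hp x = (ψ x.1).2 :=
  (h.iso p hp).diffeo.choose_spec x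

theorem fiberDiffeo_symm {p : M} (hp : p ∈ ψ.baseSet) (g : G) :
    ((h.fiberDiffeo hp).symm g : P) = ψ.toOpenPartialHomeomorph.symm (p, g) := by
  refine (symm_eq hp ((h.fiberDiffeo hp).symm g).2 ?_).symm
  rw [← h.fiberDiffeo_apply hp, Diffeomorph.apply_symm_apply]

theorem mdifferentiableAt_snd {x : P} (hx : S.proj x ∈ ψ.baseSet) :
    MDifferentiableAt 𝓘(ℝ, EP) 𝓘(ℝ, EG) (fun y => (ψ y).2) x :=
  (h.contMDiffOn_snd.contMDiffAt ((S.isOpen_preimage_baseSet ψ).mem_nhds hx)).mdifferentiableAt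
    (by simp)

/-- The chain rule for `ψ` restricted to a fibre. It replaces the fibrewise differentials by the
derivative of one map on an open subset of the total space. -/
theorem mfderiv_snd_fiberInclusion {p : M} (hp : p ∈ ψ.baseSet) (x : S.proj ⁻¹' {p})
    (v : TangentSpace 𝓘(ℝ, EG) x) :
    (mfderiv 𝓘(ℝ, EP) 𝓘(ℝ, EG) (fun y => (ψ y).2) x.1
      (mfderiv 𝓘(ℝ, EG) 𝓘(ℝ, EP) (Subtype.val : S.proj ⁻¹' {p} → P) x v) : EG) =
      mfderiv 𝓘(ℝ, EG) 𝓘(ℝ, EG) (h.fiberDiffeo hp) x v := by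
  have hx : S.proj x.1 ∈ ψ.baseSet := (show S.proj x.1 = p from x.2).symm ▸ hp
  have h1 : (h.fiberDiffeo hp : S.proj ⁻¹' {p} → G) = (fun y => (ψ y).2) ∘ Subtype.val :=
    funext fun y => h.fiberDiffeo_apply hp y
  have h2 := mfderiv_comp x (h.mdifferentiableAt_snd hx)
    ((S.contMDiff_fiber_val p).mdifferentiable (by simp) x)
  have h3 := mfderiv_congr_map (E := EG) (E' := EG) h1 x
  rw [h2] at h3
  exact (congrArg (fun L : EG →L[ℝ] EG => L v) h3).symm

end IsSymplecticTriv

/-- Following the inclusion by the derivative of the group coordinate gives the derivative of a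
diffeomorphism. -/
theorem fiberInclusion_injective {p : M} (x : S.proj ⁻¹' {p}) :
    Function.Injective (fiberInclusion S.smooth_proj (S.fiberEmbedding p) x) := by
  intro v w hvw
  obtain ⟨ψ, hp, h⟩ := S.exists_isSymplecticTriv p
  have h1 := congrArg (fun u : vertical EP EM S.proj x.1 =>
    (mfderiv 𝓘(ℝ, EP) 𝓘(ℝ, EG) (fun y => (ψ y).2) x.1 u.1 : EG)) hvw
  simp only [fiberInclusion_apply] at h1
  have h2 := (h.mfderiv_snd_fiberInclusion hp x v).symm.trans
    (Eq.trans h1 (h.mfderiv_snd_fiberInclusion hp x w))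
  exact ((h.fiberDiffeo hp).mfderivToContinuousLinearEquiv (by simp) x).injective h2

/-- Near `x` one has `y = f (proj y, y)` with `f (q, y) = ψ⁻¹ (q, (ψ y).2)`. Differentiating along a
vertical `v` kills the first slot, so `v` is the derivative along `v` of `y ↦ f (proj x, y)`, a map
with values in the fibre. -/
theorem fiberInclusion_surjective {p : M} (x : S.proj ⁻¹' {p}) :
    Function.Surjective (fiberInclusion S.smooth_proj (S.fiberEmbedding p) x) := by
  rintro ⟨v, hv⟩
  obtain ⟨ψ, hp, h⟩ := S.exists_isSymplecticTriv p
  have hx : S.proj x.1 = p := x.2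
  have hxU : S.proj x.1 ∈ ψ.baseSet := hx.symm ▸ hp
  have hU := S.isOpen_preimage_baseSet ψ
  -- the point `y` as a function of its projection and of `y` itself
  let f : M × P → P := fun z => ψ.toOpenPartialHomeomorph.symm (z.1, (ψ z.2).2)
  have hf : MDifferentiableAt (𝓘(ℝ, EM).prod 𝓘(ℝ, EP)) 𝓘(ℝ, EP) f (S.proj x.1, x.1) := by
    have h1 : ContMDiffOn (𝓘(ℝ, EM).prod 𝓘(ℝ, EP)) 𝓘(ℝ, EP) ∞ f
        (ψ.baseSet ×ˢ (S.proj ⁻¹' ψ.baseSet)) :=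
      h.contMDiffOn_symm.comp (contMDiffOn_fst.prodMk
        (h.contMDiffOn_snd.comp contMDiffOn_snd fun z hz => hz.2)) fun z hz => ⟨hz.1, mem_univ _⟩
    exact (h1.contMDiffAt ((ψ.open_baseSet.prod hU).mem_nhds
      (show (S.proj x.1, x.1) ∈ ψ.baseSet ×ˢ (S.proj ⁻¹' ψ.baseSet) from ⟨hxU, hxU⟩))).mdifferentiableAt
      (by simp)
  have hpr : MDifferentiableAt 𝓘(ℝ, EP) 𝓘(ℝ, EM) S.proj x.1 :=
    S.smooth_proj.mdifferentiable (by simp) _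
  have hdiag : HasMFDerivAt 𝓘(ℝ, EP) (𝓘(ℝ, EM).prod 𝓘(ℝ, EP)) (fun y => (S.proj y, y)) x.1
      ((mfderiv 𝓘(ℝ, EP) 𝓘(ℝ, EM) S.proj x.1).prod (ContinuousLinearMap.id ℝ _)) :=
    hpr.hasMFDerivAt.prodMk (hasMFDerivAt_id _)
  have hid : f ∘ (fun y => (S.proj y, y)) =ᶠ[𝓝 x.1] id := by
    filter_upwards [hU.mem_nhds hxU] with y hy
    exact IsSymplecticTriv.symm_eq hy rfl rfl
  have e1 := hasMFDerivAt_unique ((HasMFDerivAt.comp (f := fun y => (S.proj y, y)) x.1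
    hf.hasMFDerivAt hdiag).congr_of_eventuallyEq hid.symm)
    (hasMFDerivAt_id x.1)
  have e2 : mfderiv (𝓘(ℝ, EM).prod 𝓘(ℝ, EP)) 𝓘(ℝ, EP) f (S.proj x.1, x.1) ((0 : EM), (v : EP)) =
      (v : EP) := by
    have e3 := congrArg (fun L : EP →L[ℝ] EP => L v) e1
    have hv0 : mfderiv 𝓘(ℝ, EP) 𝓘(ℝ, EM) S.proj x.1 v = 0 := hv
    refine Eq.trans ?_ e3
    exact congrArg (fun u : EM => (mfderiv (𝓘(ℝ, EM).prod 𝓘(ℝ, EP)) 𝓘(ℝ, EP) f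
      (S.proj x.1, x.1) (u, (v : EP)) : EP)) hv0.symm
  have e5 := (mfderiv_prod_eq_add_apply (I := 𝓘(ℝ, EM)) (I' := 𝓘(ℝ, EP)) (I'' := 𝓘(ℝ, EP))
    (v := ((0 : EM), (v : EP))) hf).symm.trans e2
  -- the second partial derivative factors through the fibre
  have hfac : (fun y => f ((S.proj x.1, x.1).1, y)) =
      Subtype.val ∘ ((h.fiberDiffeo hp).symm ∘ fun y => (ψ y).2) := by
    funext y
    simp only [Function.comp_apply, h.fiberDiffeo_symm, f, hx]
  have hpt : (h.fiberDiffeo hp).symm ((ψ x.1).2) = x := by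
    rw [← h.fiberDiffeo_apply hp, Diffeomorph.symm_apply_apply]
  have hd1 : MDifferentiableAt 𝓘(ℝ, EP) 𝓘(ℝ, EG) ((h.fiberDiffeo hp).symm ∘ fun y => (ψ y).2) x.1 :=
    ((h.fiberDiffeo hp).symm.contMDiff.mdifferentiable (by simp) _).comp x.1
      (h.mdifferentiableAt_snd hxU)
  have hd2 := mfderiv_comp x.1 ((S.contMDiff_fiber_val p).mdifferentiable (by simp)
    (((h.fiberDiffeo hp).symm ∘ fun y => (ψ y).2) x.1)) hd1
  have e4 := mfderiv_congr_map (E := EP) (E' := EP) hfac x.1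
  rw [hd2] at e4
  refine ⟨(mfderiv 𝓘(ℝ, EP) 𝓘(ℝ, EG) ((h.fiberDiffeo hp).symm ∘ fun y => (ψ y).2) x.1 v : EG),
    Subtype.ext ?_⟩
  refine (S.fiberInclusion_apply x _).trans ?_
  refine Eq.trans (congrArg (fun L : EG →L[ℝ] EP => L _)
    (mfderiv_congr_base (E := EG) (E' := EP) (Subtype.val : S.proj ⁻¹' {p} → P) hpt.symm)) ?_
  refine Eq.trans (congrArg (fun L : EP →L[ℝ] EP => L v) e4.symm) ?_
  refine Eq.trans ?_ e5
  refine Eq.trans (zero_add (_ : EP)).symm ?_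
  exact congrArg (fun u : EP => u + _) (map_zero _).symm

/-- The Lie algebra of the fibre over `p`, as the fibre of the Lie algebroid. -/
noncomputable def fiberEquiv (p : M) :
    GroupLieAlgebra 𝓘(ℝ, EG) (S.proj ⁻¹' {p}) ≃ₗ[ℝ] S.groupoid.A EP EM p :=
  LinearEquiv.ofBijective (fiberInclusion S.smooth_proj (S.fiberEmbedding p) 1)
    ⟨S.fiberInclusion_injective 1, S.fiberInclusion_surjective 1⟩

theorem coe_fiberEquiv (p : M) (v : GroupLieAlgebra 𝓘(ℝ, EG) (S.proj ⁻¹' {p})) :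
    (S.fiberEquiv p v : TangentSpace 𝓘(ℝ, EP) (S.groupoid.u p)) =
      mfderiv 𝓘(ℝ, EG) 𝓘(ℝ, EP) (Subtype.val : S.proj ⁻¹' {p} → P) 1 v := rfl

end Algebroid

end SymplecticLieGroupBundle

/-! ### Left-invariant vector fields: restriction to the fibres and smoothness. -/

namespace SymplecticLieGroupBundle

section LeftInvariant

variable {EG : Type*} [NormedAddCommGroup EG] [NormedSpace ℝ EG]
  {EP : Type*} [NormedAddCommGroup EP] [NormedSpace ℝ EP]
  {EM : Type*} [NormedAddCommGroup EM] [NormedSpace ℝ EM]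
  {G : Type*} [TopologicalSpace G] [ChartedSpace EG G] [Group G] [LieGroup 𝓘(ℝ, EG) ∞ G]
  {P : Type*} [TopologicalSpace P] [ChartedSpace EP P] [IsManifold 𝓘(ℝ, EP) ∞ P]
  {M : Type*} [TopologicalSpace M] [ChartedSpace EM M]
  (S : SymplecticLieGroupBundle EP EM EG G P M)

/-- The element of the Lie algebra of the fibre over `p` which corresponds to the value of a section
of the Lie algebroid at `p`. -/
noncomputable def fiberPart {X : ∀ p, TangentSpace 𝓘(ℝ, EP) (S.groupoid.u p)}
    (hX : S.groupoid.IsSection EP EM X) (p : M) : GroupLieAlgebra 𝓘(ℝ, EG) (S.proj ⁻¹' {p}) :=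
  (S.fiberEquiv p).symm ⟨X p, hX.mem p⟩

theorem mfderiv_val_fiberPart {X : ∀ p, TangentSpace 𝓘(ℝ, EP) (S.groupoid.u p)}
    (hX : S.groupoid.IsSection EP EM X) (p : M) :
    mfderiv 𝓘(ℝ, EG) 𝓘(ℝ, EP) (Subtype.val : S.proj ⁻¹' {p} → P) 1 (S.fiberPart hX p) = X p := by
  rw [← coe_fiberEquiv, fiberPart, LinearEquiv.apply_symm_apply]

variable {S}

/-- The left-invariant vector field of a section is computed in the fibre. -/
theorem leftInv_eq_mfderiv {X : ∀ p, TangentSpace 𝓘(ℝ, EP) (S.groupoid.u p)}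
    (hX : S.groupoid.IsSection EP EM X) (x : P) :
    (S.groupoid.leftInv X x : EP) =
      mfderiv 𝓘(ℝ, EG) 𝓘(ℝ, EP)
        ((fun y => S.groupoid.mul x y) ∘ (Subtype.val : S.proj ⁻¹' {S.proj x} → P)) 1
        (S.fiberPart hX (S.proj x)) := by
  have h1 : ContMDiffOn 𝓘(ℝ, EP) 𝓘(ℝ, EP) ∞ (fun y => S.groupoid.mul x y)
      (S.proj ⁻¹' {S.proj x}) :=
    S.isLieGroupoid.smooth_mul.comp (contMDiff_const.prodMk contMDiff_id).contMDiffOn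
      fun y hy => Eq.symm hy
  have h2 : MDifferentiableWithinAt 𝓘(ℝ, EP) 𝓘(ℝ, EP) (fun y => S.groupoid.mul x y)
      (S.proj ⁻¹' {S.proj x}) ((1 : S.proj ⁻¹' {S.proj x}) : P) :=
    (h1 _ (1 : S.proj ⁻¹' {S.proj x}).2).mdifferentiableWithinAt (by simp)
  have h3 : HasMFDerivAt 𝓘(ℝ, EG) 𝓘(ℝ, EP) (Subtype.val : S.proj ⁻¹' {S.proj x} → P) 1
      (mfderiv 𝓘(ℝ, EG) 𝓘(ℝ, EP) (Subtype.val : S.proj ⁻¹' {S.proj x} → P) 1) :=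
    ((S.contMDiff_fiber_val _).mdifferentiable (by simp) 1).hasMFDerivAt
  -- The inclusion maps the whole fibre into the set, so the derivative within the `t`-fibre becomes
  -- an ordinary derivative on the fibre manifold. Uniqueness of derivatives is needed only there.
  have h4 := h2.hasMFDerivWithinAt.comp 1 (hasMFDerivWithinAt_univ.2 h3) fun y _ => y.2
  rw [(hasMFDerivWithinAt_univ.1 h4).mfderiv]
  exact congrArg (fun v : EP => (mfderivWithin 𝓘(ℝ, EP) 𝓘(ℝ, EP) (fun y => S.groupoid.mul x y)
    (S.proj ⁻¹' {S.proj x}) ((1 : S.proj ⁻¹' {S.proj x}) : P) v : EP))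
    (S.mfderiv_val_fiberPart hX (S.proj x)).symm

/-- The left-invariant vector field of a section restricts to a left-invariant vector field on each
fibre. -/
theorem leftInv_related {X : ∀ p, TangentSpace 𝓘(ℝ, EP) (S.groupoid.u p)}
    (hX : S.groupoid.IsSection EP EM X) {p : M} (g : S.proj ⁻¹' {p}) :
    mfderiv 𝓘(ℝ, EG) 𝓘(ℝ, EP) (Subtype.val : S.proj ⁻¹' {p} → P) g
      (mulInvariantVectorField (S.fiberPart hX p) g) = S.groupoid.leftInv X g.1 := by
  obtain ⟨x, hx⟩ := g
  have hx' : S.proj x = p := hx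
  subst hx'
  refine Eq.symm ((leftInv_eq_mfderiv hX x).trans ?_)
  set g : S.proj ⁻¹' {S.proj x} := ⟨x, hx⟩
  have h1 : (fun y => S.groupoid.mul x y) ∘ (Subtype.val : S.proj ⁻¹' {S.proj x} → P) =
      Subtype.val ∘ (fun y : S.proj ⁻¹' {S.proj x} => g * y) :=
    funext fun y => S.fiberMul_coe g y
  have h2 := mfderiv_congr_map (E := EG) (E' := EP) h1 1
  rw [mfderiv_comp 1 ((S.contMDiff_fiber_val _).mdifferentiable (by simp) (g * 1))
    ((contMDiff_mul_left (n := ∞)).mdifferentiable (by simp) 1)] at h2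
  refine (congrArg (fun L : EG →L[ℝ] EP => L (S.fiberPart hX (S.proj x))) h2).trans ?_
  exact congrArg (fun L : EG →L[ℝ] EP => L (mulInvariantVectorField (S.fiberPart hX (S.proj x)) g))
    (mfderiv_congr_base (E := EG) (E' := EP) (Subtype.val : S.proj ⁻¹' {S.proj x} → P) (mul_one g))

theorem leftInv_mem_vertical {X : ∀ p, TangentSpace 𝓘(ℝ, EP) (S.groupoid.u p)}
    (hX : S.groupoid.IsSection EP EM X) (x : P) :
    S.groupoid.leftInv X x ∈ vertical EP EM S.proj x := by
  rw [← leftInv_related hX (⟨x, rfl⟩ : S.proj ⁻¹' {S.proj x}), ← fiberInclusion_apply]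
  exact Subtype.prop _

theorem leftInv_unit {X : ∀ p, TangentSpace 𝓘(ℝ, EP) (S.groupoid.u p)}
    (hX : S.groupoid.IsSection EP EM X) (p : M) :
    S.groupoid.leftInv X (S.groupoid.u p) = X p := by
  have h := leftInv_related hX (1 : S.proj ⁻¹' {p})
  rw [mulInvariantVectorField_one, mfderiv_val_fiberPart] at h
  exact h.symm

/-- The left-invariant vector field of a smooth section is smooth. -/
theorem isSmoothVectorField_leftInv {X : ∀ p, TangentSpace 𝓘(ℝ, EP) (S.groupoid.u p)}
    (hX : S.groupoid.IsSection EP EM X) : IsSmoothVectorField (S.groupoid.leftInv X) := by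
  intro x₀
  obtain ⟨ψ, hp, h⟩ := S.exists_isSymplecticTriv (S.proj x₀)
  set W := S.proj ⁻¹' ψ.baseSet with hW
  have hWo : IsOpen W := S.isOpen_preimage_baseSet ψ
  -- This extension of the multiplication lives on an open set of pairs, so its tangent map is
  -- available; the field will be that tangent map on `(0, X)`.
  let m : P × P → P := fun z =>
    ψ.toOpenPartialHomeomorph.symm (S.proj z.2, (ψ z.1).2 * (ψ z.2).2)
  have hm : ContMDiffOn (𝓘(ℝ, EP).prod 𝓘(ℝ, EP)) 𝓘(ℝ, EP) ∞ m (W ×ˢ W) := h.contMDiffOn_mul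
  have hWW : IsOpen (W ×ˢ W) := hWo.prod hWo
  have h1 : ContMDiff 𝓘(ℝ, EP) 𝓘(ℝ, EP).tangent ∞
      (fun x : P => (⟨x, 0⟩ : TangentBundle 𝓘(ℝ, EP) P)) :=
    Bundle.contMDiff_zeroSection ℝ (TangentSpace 𝓘(ℝ, EP))
  have h2 : ContMDiff 𝓘(ℝ, EP) 𝓘(ℝ, EP).tangent ∞
      (fun x : P => (⟨S.groupoid.u (S.proj x), X (S.proj x)⟩ : TangentBundle 𝓘(ℝ, EP) P)) :=
    hX.smooth.comp S.smooth_proj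
  have h3 := (hm.contMDiffOn_tangentMapWithin (m := ∞) (by simp) hWW.uniqueMDiffOn).comp
    (contMDiff_equivTangentBundleProd_symm.comp (h1.prodMk h2)).contMDiffOn
    (s := W) fun x hx => ⟨hx, show S.proj (S.groupoid.u (S.proj x)) ∈ ψ.baseSet by
      rw [S.proj_unit]; exact hx⟩
  refine (ContMDiffOn.congr h3 ?_ x₀ hp).contMDiffAt (hWo.mem_nhds hp)
  intro x hx
  have hux : S.groupoid.u (S.proj x) ∈ W := by
    rw [hW, mem_preimage, S.proj_unit]
    exact hx
  have hmem : (x, S.groupoid.u (S.proj x)) ∈ W ×ˢ W := ⟨hx, hux⟩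
  have hmd : MDifferentiableAt (𝓘(ℝ, EP).prod 𝓘(ℝ, EP)) 𝓘(ℝ, EP) m
      (x, S.groupoid.u (S.proj x)) :=
    (hm.contMDiffAt (hWW.mem_nhds hmem)).mdifferentiableAt (by simp)
  have hmd' : MDifferentiableAt 𝓘(ℝ, EP) 𝓘(ℝ, EP) (fun y => m (x, y))
      (S.groupoid.u (S.proj x)) := by
    have h5 : ContMDiffOn 𝓘(ℝ, EP) 𝓘(ℝ, EP) ∞ (fun y => m (x, y)) W :=
      hm.comp (contMDiff_const.prodMk contMDiff_id).contMDiffOn fun y hy => ⟨hx, hy⟩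
    exact (h5.contMDiffAt (hWo.mem_nhds hux)).mdifferentiableAt (by simp)
  have hbase : m (x, S.groupoid.u (S.proj x)) = x :=
    (h.symm_mul (S.proj_unit _).symm hux).trans (S.groupoid.mul_u x)
  refine Bundle.TotalSpace.ext hbase.symm (heq_of_eq ?_)
  -- The extension agrees with left multiplication by `x` only on the fibre of `x`. This suffices
  -- because `X` is tangent to the fibre.
  have hfac : (fun y => S.groupoid.mul x y) ∘ (Subtype.val : S.proj ⁻¹' {S.proj x} → P) =
      (fun y => m (x, y)) ∘ (Subtype.val : S.proj ⁻¹' {S.proj x} → P) := by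
    funext y
    have hy : S.proj y.1 = S.proj x := y.2
    exact (h.symm_mul hy.symm (by rw [hy]; exact hx)).symm
  have h6 := mfderiv_congr_map (E := EG) (E' := EP) hfac 1
  have h7 := mfderiv_comp (1 : S.proj ⁻¹' {S.proj x}) hmd'
    ((S.contMDiff_fiber_val _).mdifferentiable (by simp) 1)
  rw [h7] at h6
  have h8 := (leftInv_eq_mfderiv hX x).trans
    (congrArg (fun L : EG →L[ℝ] EP => L (S.fiberPart hX (S.proj x))) h6)
  have h9 : (S.groupoid.leftInv X x : EP) = mfderiv 𝓘(ℝ, EP) 𝓘(ℝ, EP) (fun y => m (x, y))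
      (S.groupoid.u (S.proj x)) (X (S.proj x)) :=
    h8.trans (congrArg (fun v : EP => (mfderiv 𝓘(ℝ, EP) 𝓘(ℝ, EP) (fun y => m (x, y))
      (S.groupoid.u (S.proj x)) v : EP)) (S.mfderiv_val_fiberPart hX (S.proj x)))
  have h10 := mfderiv_prod_eq_add_apply (I := 𝓘(ℝ, EP)) (I' := 𝓘(ℝ, EP)) (I'' := 𝓘(ℝ, EP))
    (p := (x, S.groupoid.u (S.proj x))) (v := ((0 : EP), (X (S.proj x) : EP))) hmd
  refine h9.trans (Eq.trans ?_ (congrArg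
    (fun L : EP × EP →L[ℝ] EP => L ((0 : EP), (X (S.proj x) : EP)))
    (mfderivWithin_of_isOpen hWW hmem)).symm)
  refine Eq.trans ?_ h10.symm
  refine Eq.trans (zero_add (_ : EP)).symm ?_
  exact congrArg (fun u : EP => u + _) (map_zero _).symm

end LeftInvariant

end SymplecticLieGroupBundle

/-! ### The bracket of sections, and the quasi-Frobenius Lie algebroid. -/

namespace SymplecticLieGroupBundle

section Bracket

variable {EG : Type*} [NormedAddCommGroup EG] [NormedSpace ℝ EG]
  {EP : Type*} [NormedAddCommGroup EP] [NormedSpace ℝ EP]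
  {EM : Type*} [NormedAddCommGroup EM] [NormedSpace ℝ EM]
  {G : Type*} [TopologicalSpace G] [ChartedSpace EG G] [Group G] [LieGroup 𝓘(ℝ, EG) ∞ G]
  {P : Type*} [TopologicalSpace P] [ChartedSpace EP P] [IsManifold 𝓘(ℝ, EP) ∞ P]
  {M : Type*} [TopologicalSpace M] [ChartedSpace EM M]
  (S : SymplecticLieGroupBundle EP EM EG G P M)

/-- The Lie bracket on the fibre of the Lie algebroid, transported from the Lie algebra of the
fibre of the bundle. -/
noncomputable def fiberBracket (p : M) (v w : S.groupoid.A EP EM p) : S.groupoid.A EP EM p :=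
  S.fiberEquiv p ⁅(S.fiberEquiv p).symm v, (S.fiberEquiv p).symm w⁆

/-- Near `p`, sums and multiples of sections can be computed in a single linear trivialization of
the tangent bundle. -/
theorem eventually_unit_mem_baseSet (p : M) : ∀ᶠ q in 𝓝 p, S.groupoid.u q ∈
    (trivializationAt EP (TangentSpace 𝓘(ℝ, EP)) (S.groupoid.u p)).baseSet :=
  S.contMDiff_unit.continuous.continuousAt.eventually_mem
    ((trivializationAt EP (TangentSpace 𝓘(ℝ, EP)) (S.groupoid.u p)).open_baseSet.mem_nhds
      (FiberBundle.mem_baseSet_trivializationAt' (S.groupoid.u p)))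

/-- As `s = t`, membership in `ker t_*` is already the vanishing of the anchor. -/
theorem anchor_eq_zero (p : M) : S.groupoid.anchor EP EM p = 0 :=
  LinearMap.ext fun v => v.2

variable [CompleteSpace EG]

/-- The fibres of the Lie algebroid are quasi-Frobenius Lie algebras. -/
theorem isQuasiFrobeniusLieAlgebra_fiber (p : M) :
    IsQuasiFrobeniusLieAlgebra (S.fiberBracket p) (S.β p) := by
  refine (S.fiberSymplectic p).isQuasiFrobeniusLieAlgebra.of_linearEquiv (S.fiberEquiv p).symm
    (fun v w => ?_) (fun v w => ?_)
  · rw [fiberBracket, LinearEquiv.symm_apply_apply]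
  · obtain ⟨v, rfl⟩ := (S.fiberEquiv p).surjective v
    obtain ⟨w, rfl⟩ := (S.fiberEquiv p).surjective w
    rw [LinearEquiv.symm_apply_apply, LinearEquiv.symm_apply_apply]
    -- The fibre form at the identity is by definition the pullback of `Ω` under `fiberEquiv`.
    rfl

variable [CompleteSpace EP]

variable {S}

/-- The bracket of sections is computed pointwise. -/
theorem bracket_eq_fiberBracket {X Y : ∀ p, TangentSpace 𝓘(ℝ, EP) (S.groupoid.u p)}
    (hX : S.groupoid.IsSection EP EM X) (hY : S.groupoid.IsSection EP EM Y) (p : M) :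
    S.groupoid.bracket X Y p = (S.fiberBracket p ⟨X p, hX.mem p⟩ ⟨Y p, hY.mem p⟩ :
      S.groupoid.A EP EM p) := by
  have hd : ∀ u : GroupLieAlgebra 𝓘(ℝ, EG) (S.proj ⁻¹' {p}), MDifferentiable 𝓘(ℝ, EG)
      𝓘(ℝ, EG).tangent (fun y => (⟨y, mulInvariantVectorField u y⟩ :
        TangentBundle 𝓘(ℝ, EG) (S.proj ⁻¹' {p}))) :=
    fun u => (contMDiff_mulInvariantVectorField_infty u).mdifferentiable (by simp)
  -- The inclusion of the fibre relates its left-invariant fields to those of the groupoid; evaluate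
  -- the bracket at the identity.
  exact (mfderiv_mlieBracket_of_related ((S.contMDiff_fiber_val p).of_le (by norm_cast))
    (hd _ 1) (hd _ 1)
    ((isSmoothVectorField_leftInv hX).mdifferentiable (by simp) _)
    ((isSmoothVectorField_leftInv hY).mdifferentiable (by simp) _)
    (leftInv_related hX) (leftInv_related hY)).symm

theorem isSection_bracket {X Y : ∀ p, TangentSpace 𝓘(ℝ, EP) (S.groupoid.u p)}
    (hX : S.groupoid.IsSection EP EM X) (hY : S.groupoid.IsSection EP EM Y) :
    S.groupoid.IsSection EP EM (S.groupoid.bracket X Y) where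
  mem p := by
    rw [bracket_eq_fiberBracket hX hY]
    exact Subtype.prop _
  smooth := by
    have h : ContMDiff 𝓘(ℝ, EP) 𝓘(ℝ, EP).tangent ∞ (fun x => (⟨x, VectorField.mlieBracket 𝓘(ℝ, EP)
        (S.groupoid.leftInv X) (S.groupoid.leftInv Y) x⟩ : TangentBundle 𝓘(ℝ, EP) P)) := by
      have h2 : IsManifold 𝓘(ℝ, EP) (minSmoothness ℝ 2) P := by
        rw [minSmoothness_of_isRCLikeNormedField]
        infer_instance
      -- Because `∞ + 1 = ∞`, the bracket loses no smoothness.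
      have h3 : IsManifold 𝓘(ℝ, EP) (((⊤ : ℕ∞) : ℕ∞ω) + 1) P := by
        simpa using (inferInstance : IsManifold 𝓘(ℝ, EP) ∞ P)
      exact ContDiff.mlieBracket_vectorField (m := ⊤) (n := ⊤) (isSmoothVectorField_leftInv hX)
        (isSmoothVectorField_leftInv hY) (by simp [minSmoothness_of_isRCLikeNormedField])
    exact h.comp S.contMDiff_unit

theorem bracket_mk {X Y : ∀ p, TangentSpace 𝓘(ℝ, EP) (S.groupoid.u p)}
    (hX : S.groupoid.IsSection EP EM X) (hY : S.groupoid.IsSection EP EM Y) (p : M) :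
    (⟨S.groupoid.bracket X Y p, (isSection_bracket hX hY).mem p⟩ : S.groupoid.A EP EM p) =
      S.fiberBracket p ⟨X p, hX.mem p⟩ ⟨Y p, hY.mem p⟩ :=
  Subtype.ext (bracket_eq_fiberBracket hX hY p)

omit [CompleteSpace EG] [CompleteSpace EP] in
theorem isSection_add {X Y : ∀ p, TangentSpace 𝓘(ℝ, EP) (S.groupoid.u p)}
    (hX : S.groupoid.IsSection EP EM X) (hY : S.groupoid.IsSection EP EM Y) :
    S.groupoid.IsSection EP EM (X + Y) where
  mem p := Submodule.add_mem _ (hX.mem p) (hY.mem p)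
  smooth p := by
    have h1 := (Bundle.contMDiffAt_totalSpace.1 (hX.smooth p)).2
    have h2 := (Bundle.contMDiffAt_totalSpace.1 (hY.smooth p)).2
    refine Bundle.contMDiffAt_totalSpace.2 ⟨S.contMDiff_unit p, ?_⟩
    refine (h1.add h2).congr_of_eventuallyEq ?_
    filter_upwards [S.eventually_unit_mem_baseSet p] with q hq
    exact ((trivializationAt EP (TangentSpace 𝓘(ℝ, EP)) (S.groupoid.u p)).linear ℝ hq).map_add _ _

omit [CompleteSpace EG] [CompleteSpace EP] in
theorem isSection_smul {X : ∀ p, TangentSpace 𝓘(ℝ, EP) (S.groupoid.u p)}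
    (hX : S.groupoid.IsSection EP EM X) {f : M → ℝ} (hf : ContMDiff 𝓘(ℝ, EM) 𝓘(ℝ, ℝ) ∞ f) :
    S.groupoid.IsSection EP EM (fun p => f p • X p) where
  mem p := Submodule.smul_mem _ _ (hX.mem p)
  smooth p := by
    have h1 := (Bundle.contMDiffAt_totalSpace.1 (hX.smooth p)).2
    refine Bundle.contMDiffAt_totalSpace.2 ⟨S.contMDiff_unit p, ?_⟩
    refine ((hf p).smul h1).congr_of_eventuallyEq ?_
    filter_upwards [S.eventually_unit_mem_baseSet p] with q hq
    exact ((trivializationAt EP (TangentSpace 𝓘(ℝ, EP)) (S.groupoid.u p)).linear ℝ hq).map_smul _ _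

theorem bracket_add_right {X Y Y' : ∀ p, TangentSpace 𝓘(ℝ, EP) (S.groupoid.u p)}
    (hX : S.groupoid.IsSection EP EM X) (hY : S.groupoid.IsSection EP EM Y)
    (hY' : S.groupoid.IsSection EP EM Y') :
    S.groupoid.bracket X (Y + Y') = S.groupoid.bracket X Y + S.groupoid.bracket X Y' := by
  funext p
  rw [Pi.add_apply, bracket_eq_fiberBracket hX hY, bracket_eq_fiberBracket hX hY',
    bracket_eq_fiberBracket hX (isSection_add hY hY')]
  exact congrArg Subtype.val ((S.isQuasiFrobeniusLieAlgebra_fiber p).add_right ⟨X p, hX.mem p⟩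
    ⟨Y p, hY.mem p⟩ ⟨Y' p, hY'.mem p⟩)

theorem bracket_smul_right {X Y : ∀ p, TangentSpace 𝓘(ℝ, EP) (S.groupoid.u p)}
    (hX : S.groupoid.IsSection EP EM X) (hY : S.groupoid.IsSection EP EM Y)
    {f : M → ℝ} (hf : ContMDiff 𝓘(ℝ, EM) 𝓘(ℝ, ℝ) ∞ f) :
    S.groupoid.bracket X (fun p => f p • Y p) = fun p => f p • S.groupoid.bracket X Y p := by
  funext p
  rw [bracket_eq_fiberBracket hX hY, bracket_eq_fiberBracket hX (isSection_smul hY hf)]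
  exact congrArg Subtype.val ((S.isQuasiFrobeniusLieAlgebra_fiber p).smul_right (f p)
    ⟨X p, hX.mem p⟩ ⟨Y p, hY.mem p⟩)

omit [CompleteSpace EG] [CompleteSpace EP] in
theorem bracket_skew (X Y : ∀ p, TangentSpace 𝓘(ℝ, EP) (S.groupoid.u p)) :
    S.groupoid.bracket X Y = - S.groupoid.bracket Y X :=
  funext fun _ => VectorField.mlieBracket_swap_apply

theorem bracket_add_left {X X' Y : ∀ p, TangentSpace 𝓘(ℝ, EP) (S.groupoid.u p)}
    (hX : S.groupoid.IsSection EP EM X) (hX' : S.groupoid.IsSection EP EM X')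
    (hY : S.groupoid.IsSection EP EM Y) :
    S.groupoid.bracket (X + X') Y = S.groupoid.bracket X Y + S.groupoid.bracket X' Y := by
  rw [bracket_skew, bracket_add_right hY hX hX', bracket_skew X, bracket_skew X', neg_add]

theorem bracket_smul_left {X Y : ∀ p, TangentSpace 𝓘(ℝ, EP) (S.groupoid.u p)}
    (hX : S.groupoid.IsSection EP EM X) (hY : S.groupoid.IsSection EP EM Y)
    {f : M → ℝ} (hf : ContMDiff 𝓘(ℝ, EM) 𝓘(ℝ, ℝ) ∞ f) :
    S.groupoid.bracket (fun p => f p • X p) Y = fun p => f p • S.groupoid.bracket X Y p := by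
  rw [bracket_skew, bracket_smul_right hY hX hf, bracket_skew X]
  funext p
  exact (smul_neg _ _).symm

theorem bracket_jacobi {X Y Z : ∀ p, TangentSpace 𝓘(ℝ, EP) (S.groupoid.u p)}
    (hX : S.groupoid.IsSection EP EM X) (hY : S.groupoid.IsSection EP EM Y)
    (hZ : S.groupoid.IsSection EP EM Z) :
    S.groupoid.bracket X (S.groupoid.bracket Y Z) =
      S.groupoid.bracket (S.groupoid.bracket X Y) Z +
        S.groupoid.bracket Y (S.groupoid.bracket X Z) := by
  funext p
  rw [Pi.add_apply, bracket_eq_fiberBracket hX (isSection_bracket hY hZ),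
    bracket_eq_fiberBracket (isSection_bracket hX hY) hZ,
    bracket_eq_fiberBracket hY (isSection_bracket hX hZ),
    bracket_mk hY hZ, bracket_mk hX hY, bracket_mk hX hZ]
  exact congrArg Subtype.val ((S.isQuasiFrobeniusLieAlgebra_fiber p).jacobi ⟨X p, hX.mem p⟩
    ⟨Y p, hY.mem p⟩ ⟨Z p, hZ.mem p⟩)

variable (S)

-- This removes the derivative terms from the Leibniz rule and from `d_A β`.
omit [CompleteSpace EG] [CompleteSpace EP] in
theorem dirDeriv_anchor (f : M → ℝ) (p : M) (v : S.groupoid.A EP EM p) :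
    dirDeriv f _ (S.groupoid.anchor EP EM p v) = 0 := by
  rw [anchor_eq_zero]
  exact map_zero _

/-- The canonical groupoid of a symplectic Lie group bundle has a Lie algebroid. -/
theorem isLieAlgebroid : S.groupoid.IsLieAlgebroid EP EM where
  bracket_isSection _ _ := isSection_bracket
  bracket_add _ _ _ := bracket_add_right
  bracket_smul _ _ _ hX hY := bracket_smul_right hX hY contMDiff_const
  bracket_skew X Y _ _ := bracket_skew X Y
  jacobi _ _ _ := bracket_jacobi
  leibniz X Y hX hY f hf p := by
    rw [bracket_smul_right hX hY hf, dirDeriv_anchor, zero_smul, add_zero]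

/-- The Lie algebroid of a symplectic Lie group bundle is a quasi-Frobenius Lie algebroid. -/
theorem isQuasiFrobeniusLieAlgebroid : S.groupoid.IsQuasiFrobeniusLieAlgebroid EP EM S.β where
  isLieAlgebroid := S.isLieAlgebroid
  alt p := S.isVerticalTwoForm.alt _
  smooth X Y hX hY := by
    -- Left-invariant fields extend sections off the units, so `β(X, Y)` is `Ω(X̃, Ỹ)` composed with
    -- the unit map.
    have h := (S.isVerticalTwoForm.smooth _ _ (isSmoothVectorField_leftInv hX)
      (isSmoothVectorField_leftInv hY) (leftInv_mem_vertical hX)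
      (leftInv_mem_vertical hY)).comp S.contMDiff_unit
    refine h.congr fun p => ?_
    have hval : ∀ {V : ∀ p, TangentSpace 𝓘(ℝ, EP) (S.groupoid.u p)}
        (hV : S.groupoid.IsSection EP EM V), (⟨V p, hV.mem p⟩ : S.groupoid.A EP EM p) =
          ⟨S.groupoid.leftInv V (S.groupoid.u p), leftInv_mem_vertical hV _⟩ :=
      fun hV => Subtype.ext (leftInv_unit hV p).symm
    rw [hval hX, hval hY]
    rfl
  nondegenerate p := (S.isQuasiFrobeniusLieAlgebra_fiber p).nondegenerate
  closed X Y Z hX hY hZ p := by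
    rw [dirDeriv_anchor, dirDeriv_anchor, dirDeriv_anchor, bracket_mk hX hY,
      bracket_mk hX hZ, bracket_mk hY hZ]
    have h := (S.isQuasiFrobeniusLieAlgebra_fiber p).cocycle ⟨X p, hX.mem p⟩ ⟨Y p, hY.mem p⟩
      ⟨Z p, hZ.mem p⟩
    linarith

theorem inducesBracket_fiberBracket : S.groupoid.InducesBracket EP EM S.fiberBracket :=
  fun _ _ hX hY p => bracket_eq_fiberBracket hX hY p

end Bracket

end SymplecticLieGroupBundle

/-! ### Linear trivializations of the Lie algebroid -/

section TangentFibre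

variable {E : Type*} [NormedAddCommGroup E] [NormedSpace ℝ E]
  {N : Type*} [TopologicalSpace N] [ChartedSpace E N] [IsManifold 𝓘(ℝ, E) ∞ N]

/-- The coordinate change from a chart to itself is the identity. Hence smooth maps into a single
tangent space can be tested in the tangent bundle, and conversely. -/
theorem trivializationAt_tangent_self {x y : N} (h : y = x) (v : E) :
    (trivializationAt E (TangentSpace 𝓘(ℝ, E)) x (⟨y, v⟩ : TangentBundle 𝓘(ℝ, E) N)).2 = v := by
  subst h
  exact tangentCoordChange_self (I := 𝓘(ℝ, E)) (mem_extChartAt_source y)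

/-- The inclusion of a tangent space in the tangent bundle is smooth. -/
theorem contMDiff_tangentSpace_inclusion (x : N) :
    ContMDiff 𝓘(ℝ, E) 𝓘(ℝ, E).tangent ∞ (fun v : E => (⟨x, v⟩ : TangentBundle 𝓘(ℝ, E) N)) := by
  intro v
  refine Bundle.contMDiffAt_totalSpace.2 ⟨contMDiffAt_const, ?_⟩
  exact contMDiffAt_id.congr_of_eventuallyEq
    (Filter.Eventually.of_forall fun w => trivializationAt_tangent_self rfl w)

end TangentFibre

namespace SymplecticLieGroupBundle

section LinearTriv

variable {EG : Type*} [NormedAddCommGroup EG] [NormedSpace ℝ EG]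
  {EP : Type*} [NormedAddCommGroup EP] [NormedSpace ℝ EP]
  {EM : Type*} [NormedAddCommGroup EM] [NormedSpace ℝ EM]
  {G : Type*} [TopologicalSpace G] [ChartedSpace EG G] [Group G] [LieGroup 𝓘(ℝ, EG) ∞ G]
  {P : Type*} [TopologicalSpace P] [ChartedSpace EP P] [IsManifold 𝓘(ℝ, EP) ∞ P]
  {M : Type*} [TopologicalSpace M] [ChartedSpace EM M]
  {S : SymplecticLieGroupBundle EP EM EG G P M}

namespace IsSymplecticTriv

variable {ψ : Bundle.Trivialization G S.proj} (h : S.IsSymplecticTriv ψ)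
include h

theorem fiberDiffeo_mul {p : M} (hp : p ∈ ψ.baseSet) (x y : S.proj ⁻¹' {p}) :
    h.fiberDiffeo hp (x * y) = h.fiberDiffeo hp x * h.fiberDiffeo hp y := by
  simp only [fiberDiffeo_apply]
  exact (h.iso p hp).map_mul x y

theorem fiberDiffeo_one {p : M} (hp : p ∈ ψ.baseSet) : h.fiberDiffeo hp 1 = 1 :=
  (h.fiberDiffeo_apply hp 1).trans (h.snd_unit hp)

/-- The isomorphism from the fibre of the Lie algebroid to the Lie algebra of the model group. -/
noncomputable def linEquiv {p : M} (hp : p ∈ ψ.baseSet) :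
    S.groupoid.A EP EM p ≃ₗ[ℝ] GroupLieAlgebra 𝓘(ℝ, EG) G :=
  (S.fiberEquiv p).symm ≪≫ₗ
    LinearEquiv.ofBijective (lieAlgebraMap EG EG (h.fiberDiffeo hp)).toLinearMap
      ⟨((h.fiberDiffeo hp).mfderivToContinuousLinearEquiv (by simp) 1).injective,
        ((h.fiberDiffeo hp).mfderivToContinuousLinearEquiv (by simp) 1).surjective⟩

theorem linEquiv_fiberEquiv {p : M} (hp : p ∈ ψ.baseSet)
    (v : GroupLieAlgebra 𝓘(ℝ, EG) (S.proj ⁻¹' {p})) :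
    h.linEquiv hp (S.fiberEquiv p v) = lieAlgebraMap EG EG (h.fiberDiffeo hp) v := by
  rw [linEquiv, LinearEquiv.trans_apply, LinearEquiv.symm_apply_apply]
  rfl

/-- Exhibits the fibrewise isomorphisms as one derivative on the total space, which makes their
dependence on `p` smooth. -/
theorem linEquiv_apply {p : M} (hp : p ∈ ψ.baseSet) (v : S.groupoid.A EP EM p) :
    (h.linEquiv hp v : EG) =
      mfderiv 𝓘(ℝ, EP) 𝓘(ℝ, EG) (fun y => (ψ y).2) (S.groupoid.u p) v.1 := by
  obtain ⟨w, rfl⟩ := (S.fiberEquiv p).surjective v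
  rw [linEquiv_fiberEquiv]
  exact (h.mfderiv_snd_fiberInclusion hp 1 w).symm

/-- The inverse isomorphism is the partial derivative of `ψ⁻¹` in the group direction, again in a
form that is smooth in `p`. -/
theorem linEquiv_symm_apply {p : M} (hp : p ∈ ψ.baseSet) (a : GroupLieAlgebra 𝓘(ℝ, EG) G) :
    (mfderiv 𝓘(ℝ, EG) 𝓘(ℝ, EP) (fun g => ψ.toOpenPartialHomeomorph.symm (p, g)) 1 a : EP) =
      ((h.linEquiv hp).symm a).1 := by
  obtain ⟨v, rfl⟩ := (h.linEquiv hp).surjective a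
  obtain ⟨w, rfl⟩ := (S.fiberEquiv p).surjective v
  rw [LinearEquiv.symm_apply_apply, linEquiv_fiberEquiv, coe_fiberEquiv]
  have h1 : (fun g => ψ.toOpenPartialHomeomorph.symm (p, g)) =
      Subtype.val ∘ (h.fiberDiffeo hp).symm := funext fun g => (h.fiberDiffeo_symm hp g).symm
  have h2 : MDifferentiable 𝓘(ℝ, EG) 𝓘(ℝ, EP)
      (fun g => ψ.toOpenPartialHomeomorph.symm (p, g)) := by
    rw [h1]
    exact ((S.contMDiff_fiber_val p).comp (h.fiberDiffeo hp).symm.contMDiff).mdifferentiable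
      (by simp)
  have h3 : (fun g => ψ.toOpenPartialHomeomorph.symm (p, g)) ∘ h.fiberDiffeo hp =
      (Subtype.val : S.proj ⁻¹' {p} → P) := by
    funext x
    rw [h1, Function.comp_apply, Function.comp_apply, Diffeomorph.symm_apply_apply]
  have h4 := mfderiv_congr_map (E := EG) (E' := EP) h3 1
  rw [mfderiv_comp 1 (h2 _) ((h.fiberDiffeo hp).contMDiff.mdifferentiable (by simp) 1)] at h4
  refine Eq.trans ?_ (congrArg (fun L : EG →L[ℝ] EP => L w) h4)
  exact congrArg (fun L : EG →L[ℝ] EP => L (lieAlgebraMap EG EG (h.fiberDiffeo hp) w))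
    (mfderiv_congr_base _ (h.fiberDiffeo_one hp).symm)

theorem form_linEquiv {p : M} (hp : p ∈ ψ.baseSet) (v w : S.groupoid.A EP EM p) :
    S.σ 1 (h.linEquiv hp v) (h.linEquiv hp w) = S.β p v w := by
  obtain ⟨v, rfl⟩ := (S.fiberEquiv p).surjective v
  obtain ⟨w, rfl⟩ := (S.fiberEquiv p).surjective w
  rw [linEquiv_fiberEquiv, linEquiv_fiberEquiv]
  refine Eq.trans ?_ ((h.iso p hp).pullback 1 v w)
  have h1 : (h.fiberDiffeo hp : S.proj ⁻¹' {p} → G) = fun x => (ψ x.1).2 :=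
    funext (h.fiberDiffeo_apply hp)
  rw [h1]
  exact bilinForm_congr_point S.σ (h.snd_unit hp).symm _ _

theorem linEquiv_fiberBracket [CompleteSpace EG] {p : M} (hp : p ∈ ψ.baseSet)
    (v w : S.groupoid.A EP EM p) :
    h.linEquiv hp (S.fiberBracket p v w) = ⁅h.linEquiv hp v, h.linEquiv hp w⁆ := by
  obtain ⟨v, rfl⟩ := (S.fiberEquiv p).surjective v
  obtain ⟨w, rfl⟩ := (S.fiberEquiv p).surjective w
  rw [fiberBracket, linEquiv_fiberEquiv, linEquiv_fiberEquiv, linEquiv_fiberEquiv,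
    LinearEquiv.symm_apply_apply, LinearEquiv.symm_apply_apply]
  exact lieAlgebraMap_lie (h.fiberDiffeo hp).contMDiff (h.fiberDiffeo_mul hp) v w

/-- The local trivialization of the Lie algebroid induced by a local trivialization of the bundle. -/
noncomputable def linTriv : PartialEquiv (TangentBundle 𝓘(ℝ, EP) P) (M × EG) where
  toFun w := (S.proj w.proj, (mfderiv 𝓘(ℝ, EP) 𝓘(ℝ, EG) (fun y => (ψ y).2) w.proj w.2 : EG))
  invFun z := ⟨ψ.toOpenPartialHomeomorph.symm (z.1, 1),
    mfderiv 𝓘(ℝ, EG) 𝓘(ℝ, EP) (fun g => ψ.toOpenPartialHomeomorph.symm (z.1, g)) 1 z.2⟩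
  source := S.groupoid.totalOver EP EM ψ.baseSet
  target := ψ.baseSet ×ˢ univ
  map_source' := by
    rintro _ ⟨p, hp, v, -, rfl⟩
    exact ⟨by simpa only [S.proj_unit] using hp, mem_univ _⟩
  map_target' := by
    rintro ⟨p, a⟩ ⟨hp, -⟩
    exact ⟨p, hp, ((h.linEquiv hp).symm a).1, ((h.linEquiv hp).symm a).2,
      Bundle.TotalSpace.ext (h.symm_unit hp) (heq_of_eq (h.linEquiv_symm_apply hp a))⟩
  left_inv' := by
    rintro _ ⟨p, hp, v, hv, rfl⟩
    have h1 := h.linEquiv_apply hp ⟨v, hv⟩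
    have h2 := h.linEquiv_symm_apply hp (h.linEquiv hp ⟨v, hv⟩)
    rw [LinearEquiv.symm_apply_apply] at h2
    -- The round trip produces the base point `proj (u p)`, equal to `p` only propositionally; a
    -- free `q` can be substituted.
    have h3 : ∀ q, q = p → (⟨ψ.toOpenPartialHomeomorph.symm (q, 1),
        mfderiv 𝓘(ℝ, EG) 𝓘(ℝ, EP) (fun g => ψ.toOpenPartialHomeomorph.symm (q, g)) 1
          (mfderiv 𝓘(ℝ, EP) 𝓘(ℝ, EG) (fun y => (ψ y).2) (S.groupoid.u p) v : EG)⟩ :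
        TangentBundle 𝓘(ℝ, EP) P) = ⟨S.groupoid.u p, v⟩ := by
      intro q hq
      subst hq
      refine Bundle.TotalSpace.ext (h.symm_unit hp) (heq_of_eq (Eq.trans ?_ h2))
      exact congrArg (fun a : EG => (mfderiv 𝓘(ℝ, EG) 𝓘(ℝ, EP)
        (fun g => ψ.toOpenPartialHomeomorph.symm (q, g)) 1 a : EP)) h1.symm
    exact h3 _ (S.proj_unit p)
  right_inv' := by
    rintro ⟨p, a⟩ ⟨hp, -⟩
    have h1 := ((h.linEquiv hp).apply_symm_apply a).symm.trans
      (h.linEquiv_apply hp ((h.linEquiv hp).symm a))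
    refine Prod.ext (proj_symm hp 1) (Eq.trans ?_ h1.symm)
    refine (congrArg (fun v : EP => (mfderiv 𝓘(ℝ, EP) 𝓘(ℝ, EG) (fun y => (ψ y).2)
      (ψ.toOpenPartialHomeomorph.symm (p, 1)) v : EG)) (h.linEquiv_symm_apply hp a)).trans ?_
    exact congrArg (fun L : EP →L[ℝ] EG => L ((h.linEquiv hp).symm a).1)
      (mfderiv_congr_base _ (h.symm_unit hp))

theorem linTriv_apply {p : M} (hp : p ∈ ψ.baseSet) (v : S.groupoid.A EP EM p) :
    h.linTriv ⟨S.groupoid.u p, v⟩ = (p, h.linEquiv hp v) :=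
  Prod.ext (S.proj_unit p) (h.linEquiv_apply hp v).symm

theorem linTriv_symm_apply {p : M} (hp : p ∈ ψ.baseSet) (a : EG) :
    h.linTriv.symm (p, a) =
      (⟨S.groupoid.u p, ((h.linEquiv hp).symm a).1⟩ : TangentBundle 𝓘(ℝ, EP) P) :=
  Bundle.TotalSpace.ext (h.symm_unit hp) (heq_of_eq (h.linEquiv_symm_apply hp a))

/-- The second component is the tangent map of the group coordinate. On `AE` its values lie over
`1`, where the trivialization of `TG` at `1` is the identity. -/
theorem contMDiffOn_linTriv :
    ContMDiffOn 𝓘(ℝ, EP).tangent (𝓘(ℝ, EM).prod 𝓘(ℝ, EG)) ∞ h.linTriv h.linTriv.source := by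
  set W := S.proj ⁻¹' ψ.baseSet with hW
  have hWo : IsOpen W := S.isOpen_preimage_baseSet ψ
  have h1 : ContMDiffOn 𝓘(ℝ, EP).tangent 𝓘(ℝ, EM) ∞
      (fun w : TangentBundle 𝓘(ℝ, EP) P => S.proj w.proj) h.linTriv.source :=
    (S.smooth_proj.comp (Bundle.contMDiff_proj (TangentSpace 𝓘(ℝ, EP)))).contMDiffOn
  have h2 : ContMDiffOn 𝓘(ℝ, EP).tangent 𝓘(ℝ, EG).tangent ∞
      (tangentMapWithin 𝓘(ℝ, EP) 𝓘(ℝ, EG) (fun y => (ψ y).2) W) h.linTriv.source := by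
    refine (h.contMDiffOn_snd.contMDiffOn_tangentMapWithin (m := ∞) (by simp)
      hWo.uniqueMDiffOn).mono ?_
    rintro _ ⟨p, hp, v, -, rfl⟩
    show S.proj (S.groupoid.u p) ∈ ψ.baseSet
    rwa [S.proj_unit]
  have h3 : ContMDiffOn 𝓘(ℝ, EG).tangent (𝓘(ℝ, EG).prod 𝓘(ℝ, EG)) ∞
      (trivializationAt EG (TangentSpace 𝓘(ℝ, EG)) (1 : G))
      (trivializationAt EG (TangentSpace 𝓘(ℝ, EG)) (1 : G)).source :=
    Bundle.Trivialization.contMDiffOn _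
  have hone : ∀ w ∈ h.linTriv.source, (ψ w.proj).2 = 1 := by
    rintro _ ⟨p, hp, v, -, rfl⟩
    exact h.snd_unit hp
  have h4 := contMDiff_snd.comp_contMDiffOn (h3.comp h2 fun w hw => by
    rw [mem_preimage, Bundle.Trivialization.mem_source]
    have : (tangentMapWithin 𝓘(ℝ, EP) 𝓘(ℝ, EG) (fun y => (ψ y).2) W w).proj = 1 := hone w hw
    rw [this]
    exact FiberBundle.mem_baseSet_trivializationAt' (1 : G))
  refine (h1.prodMk h4).congr fun w hw => Prod.ext rfl ?_
  have hwW : w.proj ∈ W := by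
    obtain ⟨p, hp, v, -, rfl⟩ := hw
    show S.proj (S.groupoid.u p) ∈ ψ.baseSet
    rwa [S.proj_unit]
  refine Eq.symm ((trivializationAt_tangent_self (hone w hw) _).trans ?_)
  exact congrArg (fun L : EP →L[ℝ] EG => L w.2) (mfderivWithin_of_isOpen hWo hwW)

/-- The inverse is the tangent map of `ψ⁻¹` applied to `(0, a)` over `(p, 1)`. -/
theorem contMDiffOn_linTriv_symm [IsManifold 𝓘(ℝ, EM) ∞ M] :
    ContMDiffOn (𝓘(ℝ, EM).prod 𝓘(ℝ, EG)) 𝓘(ℝ, EP).tangent ∞ h.linTriv.symm h.linTriv.target := by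
  have ho : IsOpen (ψ.baseSet ×ˢ (univ : Set G)) := ψ.open_baseSet.prod isOpen_univ
  have h1 : ContMDiff (𝓘(ℝ, EM).prod 𝓘(ℝ, EG)) 𝓘(ℝ, EM).tangent ∞
      (fun z : M × EG => (⟨z.1, 0⟩ : TangentBundle 𝓘(ℝ, EM) M)) :=
    (Bundle.contMDiff_zeroSection ℝ (TangentSpace 𝓘(ℝ, EM))).comp contMDiff_fst
  have h2 : ContMDiff (𝓘(ℝ, EM).prod 𝓘(ℝ, EG)) 𝓘(ℝ, EG).tangent ∞
      (fun z : M × EG => (⟨1, z.2⟩ : TangentBundle 𝓘(ℝ, EG) G)) :=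
    (contMDiff_tangentSpace_inclusion 1).comp contMDiff_snd
  have h3 := (h.contMDiffOn_symm.contMDiffOn_tangentMapWithin (m := ∞) (by simp)
    ho.uniqueMDiffOn).comp
    (contMDiff_equivTangentBundleProd_symm.comp (h1.prodMk h2)).contMDiffOn
    (s := h.linTriv.target) fun z hz => ⟨hz.1, mem_univ _⟩
  refine h3.congr ?_
  rintro ⟨p, a⟩ ⟨hp, -⟩
  refine Bundle.TotalSpace.ext rfl (heq_of_eq ?_)
  have hmem : (p, (1 : G)) ∈ ψ.baseSet ×ˢ (univ : Set G) := ⟨hp, mem_univ _⟩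
  have h4 : MDifferentiableAt (𝓘(ℝ, EM).prod 𝓘(ℝ, EG)) 𝓘(ℝ, EP)
      (fun z => ψ.toOpenPartialHomeomorph.symm z) (p, 1) :=
    (h.contMDiffOn_symm.contMDiffAt (ho.mem_nhds hmem)).mdifferentiableAt (by simp)
  have h5 := mfderiv_prod_eq_add_apply (I := 𝓘(ℝ, EM)) (I' := 𝓘(ℝ, EG)) (I'' := 𝓘(ℝ, EP))
    (v := ((0 : EM), (a : EG))) h4
  refine Eq.trans ?_ ((congrArg (fun L : EM × EG →L[ℝ] EP => L ((0 : EM), a))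
    (mfderivWithin_of_isOpen ho hmem)).trans h5).symm
  refine Eq.trans (zero_add (_ : EP)).symm ?_
  exact congrArg (fun u : EP => u + _) (map_zero _).symm

end IsSymplecticTriv

end LinearTriv

/-! ### Extension of vectors to sections, and uniqueness of the fibre brackets. -/

section Extension

variable {EG : Type*} [NormedAddCommGroup EG] [NormedSpace ℝ EG]
  {EP : Type*} [NormedAddCommGroup EP] [NormedSpace ℝ EP]
  {EM : Type*} [NormedAddCommGroup EM] [NormedSpace ℝ EM] [FiniteDimensional ℝ EM]
  {G : Type*} [TopologicalSpace G] [ChartedSpace EG G] [Group G] [LieGroup 𝓘(ℝ, EG) ∞ G]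
  {P : Type*} [TopologicalSpace P] [ChartedSpace EP P] [IsManifold 𝓘(ℝ, EP) ∞ P]
  {M : Type*} [TopologicalSpace M] [ChartedSpace EM M] [IsManifold 𝓘(ℝ, EM) ∞ M] [T2Space M]
  (S : SymplecticLieGroupBundle EP EM EG G P M)

/-- Every vector in the Lie algebroid is the value of a smooth section. -/
theorem exists_isSection_eq (p : M) (v : S.groupoid.A EP EM p) :
    ∃ X : ∀ q, TangentSpace 𝓘(ℝ, EP) (S.groupoid.u q),
      S.groupoid.IsSection EP EM X ∧ X p = v.1 := by
  classical
  obtain ⟨ψ, hp, h⟩ := S.exists_isSymplecticTriv p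
  obtain ⟨f, -, hf⟩ := (SmoothBumpFunction.nhds_basis_tsupport (I := 𝓘(ℝ, EM)) p).mem_iff.1
    (ψ.open_baseSet.mem_nhds hp)
  let a : GroupLieAlgebra 𝓘(ℝ, EG) G := h.linEquiv hp v
  -- The constant section `a` in the trivialization, cut off by a bump function supported in the
  -- base set and extended by zero.
  let X : ∀ q, S.groupoid.A EP EM q := fun q =>
    if hq : q ∈ ψ.baseSet then (h.linEquiv hq).symm (f q • a) else 0
  have hXU : ∀ q (hq : q ∈ ψ.baseSet), X q = (h.linEquiv hq).symm (f q • a) :=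
    fun q hq => dif_pos hq
  have hX0 : ∀ q, f q = 0 → X q = 0 := by
    intro q hq
    by_cases hqU : q ∈ ψ.baseSet
    · rw [hXU q hqU, hq, zero_smul, map_zero]
    · exact dif_neg hqU
  refine ⟨fun q => (X q).1, ⟨fun q => (X q).2, fun q => ?_⟩, ?_⟩
  · by_cases hq : q ∈ ψ.baseSet
    · let a' : EG := a
      have h1 : ContMDiff 𝓘(ℝ, EM) (𝓘(ℝ, EM).prod 𝓘(ℝ, EG)) ∞
          (fun q : M => (q, f q • a')) :=
        contMDiff_id.prodMk (f.contMDiff.smul contMDiff_const)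
      have h2 := h.contMDiffOn_linTriv_symm.comp h1.contMDiffOn (s := ψ.baseSet)
        fun q hq => (⟨hq, mem_univ _⟩ : (q, f q • a') ∈ ψ.baseSet ×ˢ univ)
      refine (h2.congr (fun q hq => ?_) q hq).contMDiffAt (ψ.open_baseSet.mem_nhds hq)
      rw [Function.comp_apply, h.linTriv_symm_apply hq, hXU q hq]
      rfl
    -- A point outside the base set has a neighbourhood missing the support, on which the section is
    -- the zero section.
    · have h1 : ContMDiff 𝓘(ℝ, EM) 𝓘(ℝ, EP).tangent ∞
          (fun q => (⟨S.groupoid.u q, 0⟩ : TangentBundle 𝓘(ℝ, EP) P)) :=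
        (Bundle.contMDiff_zeroSection ℝ (TangentSpace 𝓘(ℝ, EP))).comp S.contMDiff_unit
      refine (h1 q).congr_of_eventuallyEq ?_
      filter_upwards [(isClosed_tsupport f).isOpen_compl.mem_nhds fun hq' => hq (hf hq')] with r hr
      rw [hX0 r (image_eq_zero_of_notMem_tsupport hr)]
      rfl
  · show (X p).1 = v.1
    rw [hXU p hp, f.eq_one, one_smul, LinearEquiv.symm_apply_apply]

/-- Any two vectors of a fibre are values of sections, so the bracket of sections determines the
fibre bracket. -/
theorem eq_of_inducesBracket {b b' : ∀ p, S.groupoid.A EP EM p → S.groupoid.A EP EM p →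
    S.groupoid.A EP EM p} (hb : S.groupoid.InducesBracket EP EM b)
    (hb' : S.groupoid.InducesBracket EP EM b') : b' = b := by
  funext p v w
  obtain ⟨X, hX, hv⟩ := S.exists_isSection_eq p v
  obtain ⟨Y, hY, hw⟩ := S.exists_isSection_eq p w
  have hv' : (⟨X p, hX.mem p⟩ : S.groupoid.A EP EM p) = v := Subtype.ext hv
  have hw' : (⟨Y p, hY.mem p⟩ : S.groupoid.A EP EM p) = w := Subtype.ext hw
  have h1 := (hb' X Y hX hY p).symm.trans (hb X Y hX hY p)
  rw [hv', hw'] at h1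
  exact Subtype.ext h1

end Extension

end SymplecticLieGroupBundle

/-! ### Assembly of the main theorem. -/

theorem proposition4p3
    {EG : Type*} [NormedAddCommGroup EG] [NormedSpace ℝ EG] [FiniteDimensional ℝ EG]
    {EP : Type*} [NormedAddCommGroup EP] [NormedSpace ℝ EP] [FiniteDimensional ℝ EP]
    {EM : Type*} [NormedAddCommGroup EM] [NormedSpace ℝ EM] [FiniteDimensional ℝ EM]
    {G : Type*} [TopologicalSpace G] [ChartedSpace EG G] [Group G] [LieGroup 𝓘(ℝ, EG) ∞ G]
    [T2Space G]
    {P : Type*} [TopologicalSpace P] [ChartedSpace EP P] [IsManifold 𝓘(ℝ, EP) ∞ P] [T2Space P]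
    {M : Type*} [TopologicalSpace M] [ChartedSpace EM M] [IsManifold 𝓘(ℝ, EM) ∞ M] [T2Space M]
    (S : SymplecticLieGroupBundle EP EM EG G P M) :
    -- the associated object is a quasi-Frobenius Lie algebroid of a Lie groupoid
    S.groupoid.IsLieGroupoid EP EM ∧
    S.groupoid.IsQuasiFrobeniusLieAlgebroid EP EM S.β ∧
    -- (i) the anchor vanishes
    (∀ p, S.groupoid.anchor EP EM p = 0) ∧
    -- (ii) the bracket of sections is bilinear over the smooth functions on `M`
    (∀ X X' Y, S.groupoid.IsSection EP EM X → S.groupoid.IsSection EP EM X' →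
      S.groupoid.IsSection EP EM Y →
      S.groupoid.bracket (X + X') Y = S.groupoid.bracket X Y + S.groupoid.bracket X' Y ∧
      S.groupoid.bracket Y (X + X') = S.groupoid.bracket Y X + S.groupoid.bracket Y X') ∧
    (∀ X Y, S.groupoid.IsSection EP EM X → S.groupoid.IsSection EP EM Y →
      ∀ f : M → ℝ, ContMDiff 𝓘(ℝ, EM) 𝓘(ℝ, ℝ) ∞ f →
      S.groupoid.bracket (fun p => f p • X p) Y = (fun p => f p • S.groupoid.bracket X Y p) ∧
      S.groupoid.bracket X (fun p => f p • Y p) = (fun p => f p • S.groupoid.bracket X Y p)) ∧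
    -- hence it is induced by unique brackets `b` on the fibres of `AE`
    ∃ b : ∀ p, S.groupoid.A EP EM p → S.groupoid.A EP EM p → S.groupoid.A EP EM p,
      S.groupoid.InducesBracket EP EM b ∧
      (∀ b', S.groupoid.InducesBracket EP EM b' → b' = b) ∧
      -- the fibres and `(𝔤, σ_e)` are quasi-Frobenius Lie algebras
      (∀ p, IsQuasiFrobeniusLieAlgebra (b p) (S.β p)) ∧
      IsQuasiFrobeniusLieAlgebra (V := GroupLieAlgebra 𝓘(ℝ, EG) G)
        (fun x y => ⁅x, y⁆) (S.σ 1) ∧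
      -- (iii) local trivializations `φ : π_{AE}⁻¹(U) → U × 𝔤` by isomorphisms of quasi-Frobenius
      -- Lie algebras; `𝔤 = T_e G` is, as a manifold, the model vector space `EG` of `G`
      ∀ p₀ : M, ∃ (U : Set M) (φ : PartialEquiv (TangentBundle 𝓘(ℝ, EP) P) (M × EG)),
        IsOpen U ∧ p₀ ∈ U ∧
        φ.source = S.groupoid.totalOver EP EM U ∧ φ.target = U ×ˢ univ ∧
        ContMDiffOn 𝓘(ℝ, EP).tangent (𝓘(ℝ, EM).prod 𝓘(ℝ, EG)) ∞ φ φ.source ∧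
        ContMDiffOn (𝓘(ℝ, EM).prod 𝓘(ℝ, EG)) 𝓘(ℝ, EP).tangent ∞ φ.symm φ.target ∧
        ∀ p ∈ U, ∃ φp : S.groupoid.A EP EM p ≃ₗ[ℝ] GroupLieAlgebra 𝓘(ℝ, EG) G,
          (∀ v : S.groupoid.A EP EM p, φ ⟨S.groupoid.u p, v⟩ = (p, φp v)) ∧
          (∀ v w, φp (b p v w) = ⁅φp v, φp w⁆) ∧
          (∀ v w, S.σ 1 (φp v) (φp w) = S.β p v w) := by
  -- The results on Lie brackets need complete model spaces; finite dimension supplies this.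
  have hEG : CompleteSpace EG := FiniteDimensional.complete ℝ EG
  have hEP : CompleteSpace EP := FiniteDimensional.complete ℝ EP
  refine ⟨S.isLieGroupoid, S.isQuasiFrobeniusLieAlgebroid, S.anchor_eq_zero,
    fun X X' Y hX hX' hY => ⟨SymplecticLieGroupBundle.bracket_add_left hX hX' hY,
      SymplecticLieGroupBundle.bracket_add_right hY hX hX'⟩,
    fun X Y hX hY f hf => ⟨SymplecticLieGroupBundle.bracket_smul_left hX hY hf,
      SymplecticLieGroupBundle.bracket_smul_right hX hY hf⟩,
    S.fiberBracket, S.inducesBracket_fiberBracket,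
    fun b' hb' => S.eq_of_inducesBracket S.inducesBracket_fiberBracket hb',
    S.isQuasiFrobeniusLieAlgebra_fiber, S.isSymplecticLieGroup.isQuasiFrobeniusLieAlgebra,
    fun p₀ => ?_⟩
  obtain ⟨ψ, hp₀, h⟩ := S.exists_isSymplecticTriv p₀
  exact ⟨ψ.baseSet, h.linTriv, ψ.open_baseSet, hp₀, rfl, rfl, h.contMDiffOn_linTriv,
    h.contMDiffOn_linTriv_symm, fun p hp => ⟨h.linEquiv hp, h.linTriv_apply hp,
      h.linEquiv_fiberBracket hp, h.form_linEquiv hp⟩⟩
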